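/- **Conventions.** All graphs are finite and simple. A connected graph with $n$ vertices and $n+1$ edges is called bicyclic. A non-increasing sequence $\pi=(d_1,\dots,d_n)$ is a bicyclic degree sequence if it is the degree sequence of some bicyclic graph, and $\Gamma(\pi)$ denotes the class of connected graphs with degree sequence $\pi$. The symbol $p^{(q)}$ means $q$ copies of $p$. A real-valued function $f(x,y)$ of two positive real variables with $f(x,y)=f(y,x)$ is escalating if $$f(x_1,x_2)+f(y_1,y_2)\ \ge\ f(x_2,y_1)+f(x_1,y_2)\qquad\text{for all } x_1\ge y_1>0,\ x_2\ge y_2>0,$$ with strict inequality whenever $x_1>y_1$ and $x_2>y_2$; it is de-escalating if the reversed inequalities hold. Put $M_f(G)=\sum_{uv\in E(G)}f(d(u),d(v))$. A BFS-ordering of a connected graph $G$ is an ordering $v_1\prec v_2\prec\dots\prec v_n$ of $V(G)$ such that, with $h(v)$ the distance from $v$ to $v_1$: (a) $d(v_1)\ge\dots\ge d(v_n)$ and $h(v_1)\le\dots\le h(v_n)$; (b) if $v\in N(u)\setminus N(w)$, $z\in N(w)\setminus N(u)$, $h(u)=h(w)=h(v)-1=h(z)-1$ and $u\prec w$, then $v\prec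 z$. The base graph $\mathcal R(G)$ is obtained from $G$ by recursively deleting pendant vertices until none remain. **Graphs.** $B_1$ consists of two triangles sharing exactly one edge, $B_2$ of two triangles sharing exactly one vertex. A graph $B_3$ consists of two cycles sharing exactly one vertex, and a graph $B_5$ of two cycles sharing exactly one edge together with its two ends (the cycles may have any lengths $\ge 3$). **Construction.** Let $\pi=(d_1,\dots,d_n)$ be a bicyclic degree sequence. A graph $B$ is called a graph $B_M(\pi)$ in each of the following cases. 1. $d_1\ge d_2\ge 3$ and $d_n=1$: $B$ has a BFS-ordering $v_1\prec\dots\prec v_n$ with $d(v_i)=d_i$ for all $i$, and $\mathcal R(B)\cong B_1$ has vertex set $\{v_1,v_2,v_3,v_4\}$ and consists of the triangles $v_1v_2v_3$ and $v_1v_2v_4$. 2. $d_1\ge 5>d_2=2$ and $d_n=1$: $B$ is a graph with $n$ vertices obtained from $B_2$ by attaching $d_1-4$ non-empty paths, whose numbers of vertices pairwise differ by at most $1$, to the vertex of degree four of $B_2$ (each path by an edge from one of its ends). 3. $\pi=(4,2^{(n-1)})$: $B$ is a graph $B_3$ with $n$ vertices. 4. $\pi=(3^{(2)},2^{(n-2)})$: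 $B$ is a graph $B_5$ with $n$ vertices. **Theorem.** Let $\pi$ be a bicyclic degree sequence. Then $\pi$ falls under one of the four cases and a graph $B_M(\pi)$ exists. Moreover, every graph $B$ that is a $B_M(\pi)$ is an extremal graph of $\Gamma(\pi)$, that is, $B\in\Gamma(\pi)$ and, for every $f$: if $f$ is escalating, then $M_f(G)\le M_f(B)$ for all $G\in\Gamma(\pi)$; if $f$ is de-escalating, then $M_f(G)\ge M_f(B)$ for all $G\in\Gamma(\pi)$. -/

import Mathlib

universe u

namespace Bicyclic

open Classical in
/-- `G` has `n` vertices, which can be labelled `v₁, …, vₙ` so that `d(vᵢ) = πᵢ`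
(indices start at `0` in the code). -/
def HasDegreeSequence {n : ℕ} {V : Type*} [Fintype V] (π : Fin n → ℕ) (G : SimpleGraph V) :
    Prop :=
  ∃ v : Fin n ≃ V, ∀ i, G.degree (v i) = π i

/-- The class `Γ(π)` of connected graphs with degree sequence `π`. -/
def InGamma {n : ℕ} {V : Type*} [Fintype V] (π : Fin n → ℕ) (G : SimpleGraph V) : Prop :=
  G.Connected ∧ HasDegreeSequence π G

/-- A connected graph with `n` vertices and `n + 1` edges. -/
def IsBicyclic {V : Type*} [Fintype V] (G : SimpleGraph V) : Prop :=
  G.Connected ∧ G.edgeSet.ncard = Fintype.card V + 1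

/-- A non-increasing sequence which is the degree sequence of a bicyclic graph. -/
def IsBicyclicDegreeSequence {n : ℕ} (π : Fin n → ℕ) : Prop :=
  Antitone π ∧ ∃ G : SimpleGraph (Fin n), IsBicyclic G ∧ HasDegreeSequence π G

/-- Symmetric functions of two positive real variables which are escalating. -/
structure IsEscalating (f : ℝ → ℝ → ℝ) : Prop where
  symm : ∀ x y, 0 < x → 0 < y → f x y = f y x
  le : ∀ x₁ y₁ x₂ y₂, 0 < y₁ → y₁ ≤ x₁ → 0 < y₂ → y₂ ≤ x₂ →
    f x₂ y₁ + f x₁ y₂ ≤ f x₁ x₂ + f y₁ y₂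
  lt : ∀ x₁ y₁ x₂ y₂, 0 < y₁ → y₁ < x₁ → 0 < y₂ → y₂ < x₂ →
    f x₂ y₁ + f x₁ y₂ < f x₁ x₂ + f y₁ y₂

/-- Symmetric functions of two positive real variables which are de-escalating. -/
structure IsDeEscalating (f : ℝ → ℝ → ℝ) : Prop where
  symm : ∀ x y, 0 < x → 0 < y → f x y = f y x
  le : ∀ x₁ y₁ x₂ y₂, 0 < y₁ → y₁ ≤ x₁ → 0 < y₂ → y₂ ≤ x₂ →
    f x₁ x₂ + f y₁ y₂ ≤ f x₂ y₁ + f x₁ y₂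
  lt : ∀ x₁ y₁ x₂ y₂, 0 < y₁ → y₁ < x₁ → 0 < y₂ → y₂ < x₂ →
    f x₁ x₂ + f y₁ y₂ < f x₂ y₁ + f x₁ y₂

open Classical in
/-- The connectivity function `M_f(G) = ∑_{uv ∈ E(G)} f(d(u), d(v))`. Each edge is read as a pair
of its end vertices by `Quot.out`; the order does not matter, as `f` is symmetric on positive
numbers and end vertices of edges have positive degree. -/
noncomputable def connectivity {V : Type*} [Fintype V] (f : ℝ → ℝ → ℝ) (G : SimpleGraph V) : ℝ :=
  ∑ e ∈ G.edgeFinset, f (G.degree (Quot.out e).1) (G.degree (Quot.out e).2)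

/-- `B` is an extremal graph of `Γ(π)` with respect to `f`: it lies in `Γ(π)`, it maximizes `M_f`
there if `f` is escalating, and it minimizes `M_f` there if `f` is de-escalating. -/
def IsExtremal {n : ℕ} {V : Type u} [Fintype V] (f : ℝ → ℝ → ℝ) (π : Fin n → ℕ)
    (B : SimpleGraph V) : Prop :=
  InGamma π B ∧
  (IsEscalating f → ∀ (W : Type u) [Fintype W] (G : SimpleGraph W),
    InGamma π G → connectivity f G ≤ connectivity f B) ∧
  (IsDeEscalating f → ∀ (W : Type u) [Fintype W] (G : SimpleGraph W),
    InGamma π G → connectivity f B ≤ connectivity f G)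

open Classical in
/-- `v₁ ≺ v₂ ≺ ⋯ ≺ vₙ` (here `v 0, v 1, …`) is an ordering of the vertices of the connected graph
`G` that makes `G` a BFS-graph; the height of a vertex is its distance to the first vertex. -/
structure IsBFSOrdering {n : ℕ} [NeZero n] {V : Type*} [Fintype V] (G : SimpleGraph V)
    (v : Fin n ≃ V) : Prop where
  connected : G.Connected
  degree_anti : ∀ i j, i ≤ j → G.degree (v j) ≤ G.degree (v i)
  height_mono : ∀ i j, i ≤ j → G.dist (v 0) (v i) ≤ G.dist (v 0) (v j)
  children : ∀ u w x z : Fin n,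
    G.Adj (v u) (v x) → ¬ G.Adj (v w) (v x) → G.Adj (v w) (v z) → ¬ G.Adj (v u) (v z) →
    G.dist (v 0) (v u) = G.dist (v 0) (v w) →
    G.dist (v 0) (v x) = G.dist (v 0) (v u) + 1 →
    G.dist (v 0) (v z) = G.dist (v 0) (v u) + 1 →
    u < w → x < z

/-- One round of deletions: keep the vertices of `S` with at least two neighbours in `S`.
(Isolated vertices are deleted too, so that trees get an empty base graph.) -/
def prune {V : Type*} (G : SimpleGraph V) (S : Set V) : Set V :=
  {x ∈ S | 2 ≤ (G.neighborSet x ∩ S).ncard}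

/-- The vertices of `G` that survive the recursive deletion of pendant vertices. -/
def baseSet {V : Type*} (G : SimpleGraph V) : Set V :=
  ⋂ k : ℕ, (prune G)^[k] Set.univ

/-- The base graph `R(G)`. -/
def baseGraph {V : Type*} (G : SimpleGraph V) : SimpleGraph (baseSet G) :=
  G.induce (baseSet G)

/-- `B₁`: two triangles `012` and `013` sharing the edge `01`, that is, `K₄` minus an edge. -/
def B₁ : SimpleGraph (Fin 4) :=
  SimpleGraph.fromEdgeSet {s(0, 1), s(0, 2), s(1, 2), s(0, 3), s(1, 3)}

/-- `B₂`: two triangles `012` and `034` sharing the vertex `0`. -/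
def B₂ : SimpleGraph (Fin 5) :=
  SimpleGraph.fromEdgeSet {s(0, 1), s(1, 2), s(0, 2), s(0, 3), s(3, 4), s(0, 4)}

/-- `B₃` on `n` vertices: the cycles `0, 1, …, p - 1` and `0, p, …, n - 1`, sharing only the
vertex `0`. It is used for `3 ≤ p` and `p + 2 ≤ n`. -/
def B₃ (n p : ℕ) : SimpleGraph (Fin n) :=
  SimpleGraph.fromRel fun i j =>
    (i.val + 1 = j.val ∧ j.val ≠ p) ∨
    (i.val = 0 ∧ (j.val + 1 = p ∨ j.val = p ∨ j.val + 1 = n))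

/-- `B₅` on `n` vertices: the cycles `0, 1, …, p - 1` and `0, p - 1, p, …, n - 1`, sharing only
the edge joining `0` and `p - 1`. It is used for `3 ≤ p` and `p + 1 ≤ n`. -/
def B₅ (n p : ℕ) : SimpleGraph (Fin n) :=
  SimpleGraph.fromRel fun i j =>
    i.val + 1 = j.val ∨ (i.val = 0 ∧ (j.val + 1 = p ∨ j.val + 1 = n))

/-- The graph obtained from `H` by attaching to its vertex `w` the paths with `l 0, l 1, …`
vertices: an end vertex of each path is joined to `w`. -/
def attachPaths {W : Type*} (H : SimpleGraph W) (w : W) {k : ℕ} (l : Fin k → ℕ) :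
    SimpleGraph (W ⊕ (i : Fin k) × Fin (l i)) :=
  SimpleGraph.fromRel fun a b =>
    match a, b with
    | .inl x, .inl y => H.Adj x y
    | .inl x, .inr ⟨_, s⟩ => x = w ∧ s.val = 0
    | .inr _, .inl _ => False
    | .inr ⟨i, s⟩, .inr ⟨j, t⟩ => i = j ∧ s.val + 1 = t.val

open Classical in
/-- Case `d₁ ≥ d₂ ≥ 3`, `dₙ = 1`: a BFS-graph of degree sequence `π` whose base graph is `B₁`,
located on the first four vertices of the BFS-ordering, `v₁v₂` being the edge shared by the two
triangles; the remaining vertices follow in the BFS-ordering. -/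
def IsBM₁ {n : ℕ} [NeZero n] {V : Type*} [Fintype V] (π : Fin n → ℕ) (B : SimpleGraph V) : Prop :=
  ∃ v : Fin n ≃ V, (∀ i, B.degree (v i) = π i) ∧ IsBFSOrdering B v ∧
    ∃ φ : B₁ ≃g baseGraph B, (φ 0 : V) = v 0 ∧ (φ 1 : V) = v 1 ∧ (φ 2 : V) = v 2 ∧ (φ 3 : V) = v 3

/-- Case `d₁ ≥ 5 > d₂ = 2`, `dₙ = 1`: the graph with `n` vertices obtained from `B₂` by attaching
`d₁ - 4` (non-empty) paths of almost equal lengths to the vertex of degree four. -/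
def IsBM₂ {V : Type*} [Fintype V] (n d₁ : ℕ) (B : SimpleGraph V) : Prop :=
  Fintype.card V = n ∧ ∃ l : Fin (d₁ - 4) → ℕ, (∀ i, 1 ≤ l i) ∧ (∀ i j, l i ≤ l j + 1) ∧
    Nonempty (B ≃g attachPaths B₂ 0 l)

/-- `B` is (isomorphic to) a graph `B_M(π)`, in the four cases of the construction. The indices
`0`, `1`, `⊤` of `Fin n` are those of `d₁`, `d₂`, `dₙ`. -/
def IsBM {n : ℕ} [NeZero n] {V : Type*} [Fintype V] (π : Fin n → ℕ) (B : SimpleGraph V) : Prop :=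
  (π 1 ≤ π 0 ∧ 3 ≤ π 1 ∧ π ⊤ = 1 ∧ IsBM₁ π B) ∨
  (5 ≤ π 0 ∧ π 1 = 2 ∧ π ⊤ = 1 ∧ IsBM₂ n (π 0) B) ∨
  ((∀ i, π i = if i = 0 then 4 else 2) ∧
    ∃ p, 3 ≤ p ∧ p + 2 ≤ n ∧ Nonempty (B ≃g B₃ n p)) ∨
  ((∀ i, π i = if i = 0 ∨ i = 1 then 3 else 2) ∧
    ∃ p, 3 ≤ p ∧ p + 1 ≤ n ∧ Nonempty (B ≃g B₅ n p))

end Bicyclic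

/-! ### Reduction of the connectivity function to counts of edges between upper sets -/

namespace Bicyclic

open Finset

/-! Two-dimensional summation by parts writes `f x y`, for positive integers, as terms in one
variable plus the mixed second differences of `f` over all thresholds `s + 2 ≤ x`, `t + 2 ≤ y`.
Summed over adjacent pairs, the one-variable terms depend only on the degree sequence. What remains
combines the numbers e(U_s, U_t) of ordered adjacent pairs between the upper sets U_s of vertices of
degree at least s, and its coefficients are non-negative for escalating `f`
(`two_mul_connectivity_eq`). So it suffices that B maximizes every e(U_s, U_t) at once; a
de-escalating `f` is handled through `-f`.

For t ≤ s three bounds hold throughout Γ(π), with values read off from π: e(U_s, U_t) is at most the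
degree sum of U_s; it is at most |U_t| - 1 if U_s is a single vertex; and 2 e(U_s, U_t) ≤ e(U_s,
U_s) + e(U_t, U_t), where p vertices span at most `maxEdges p` edges by the cyclomatic number.
`AttainsBound` asks that B meet one of them for each pair (`adjCount_upperSet_le`).

In the main case the BFS-ordering yields a non-decreasing parent map, and upper sets are initial
segments of lengths p ≤ q. If all vertices from the fifth on and before q have their parents before
p, the edges to predecessors fill the second or third bound. Otherwise monotonicity keeps all
neighbours of the first p vertices among the first q, and the degree sum is attained
(`IsParentMap.attainsBound`). In the other cases all but one or two degrees are 1 or 2, so few upper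
sets need checking.

Existence in the main case comes from handing out child slots to the vertices in order;
`lt_sum_slots_add_four` shows that slots never run out too early. -/

open Classical in
/-- The number of ordered pairs `(u, v) ∈ A × B` with `u` adjacent to `v`. -/
noncomputable def adjCount {V : Type*} (G : SimpleGraph V) (A B : Finset V) : ℕ :=
  ∑ u ∈ A, ∑ v ∈ B, if G.Adj u v then 1 else 0

open Classical in
/-- The vertices of degree at least `s`. -/
noncomputable def upperSet {V : Type*} [Fintype V] (G : SimpleGraph V) (s : ℕ) : Finset V :=
  univ.filter fun v => s ≤ G.degree v

open Classical in
theorem mem_upperSet {V : Type*} [Fintype V] {G : SimpleGraph V} {s : ℕ} {v : V} :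
    v ∈ upperSet G s ↔ s ≤ G.degree v := by
  simp [upperSet]

open Classical in
theorem upperSet_subset {V : Type*} [Fintype V] {G : SimpleGraph V} {s t : ℕ} (h : t ≤ s) :
    upperSet G s ⊆ upperSet G t := fun v hv => by
  rw [mem_upperSet] at *; omega

-- Passing to ordered pairs removes the choice made by `Quot.out`: every edge has exactly two
-- orderings, and symmetry of `f` applies since ends of edges have positive degree.
open Classical in
theorem two_mul_connectivity {V : Type*} [Fintype V] (G : SimpleGraph V) (f : ℝ → ℝ → ℝ)
    (hf : ∀ x y, 0 < x → 0 < y → f x y = f y x) :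
    2 * connectivity f G =
      ∑ u, ∑ v, if G.Adj u v then f (G.degree u) (G.degree v) else 0 := by
  rw [← Fintype.sum_prod_type', ← Finset.sum_filter, connectivity, Finset.mul_sum]
  have hmap : ∀ x ∈ (univ.filter fun x : V × V => G.Adj x.1 x.2), s(x.1, x.2) ∈ G.edgeFinset := by
    intro x hx; simpa using hx
  rw [← Finset.sum_fiberwise_of_maps_to hmap]
  refine Finset.sum_congr rfl fun e he => ?_
  rcases hab : Quot.out e with ⟨a, b⟩
  have hq : e = s(a, b) := by
    have := Quot.out_eq e
    rw [hab] at this; exact this.symm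
  have hadj : G.Adj a b := by
    rw [hq] at he; simpa using he
  have hfil : ((univ.filter fun x : V × V => G.Adj x.1 x.2).filter fun x => s(x.1, x.2) = e)
      = {(a, b), (b, a)} := by
    ext ⟨x, y⟩
    simp only [mem_filter, mem_univ, true_and, hq, Sym2.eq_iff, mem_insert, mem_singleton,
      Prod.mk.injEq]
    constructor
    · rintro ⟨-, h⟩; exact h
    · rintro (⟨rfl, rfl⟩ | ⟨rfl, rfl⟩)
      · exact ⟨hadj, by simp⟩
      · exact ⟨hadj.symm, by simp⟩
  have hne : (a, b) ≠ (b, a) := by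
    intro h; simp only [Prod.mk.injEq] at h; exact hadj.ne h.1
  rw [hfil, Finset.sum_pair hne]
  have ha : (0 : ℝ) < G.degree a := by
    exact_mod_cast (G.degree_pos_iff_exists_adj a).2 ⟨b, hadj⟩
  have hb : (0 : ℝ) < G.degree b := by
    exact_mod_cast (G.degree_pos_iff_exists_adj b).2 ⟨a, hadj.symm⟩
  simp only
  rw [hf _ _ hb ha]; ring

/-- The mixed second difference of `f` at the positive integers. -/
def mixedDiff (f : ℝ → ℝ → ℝ) (s t : ℕ) : ℝ :=
  f (s + 2 : ℕ) (t + 2 : ℕ) - f (s + 1 : ℕ) (t + 2 : ℕ) - f (s + 2 : ℕ) (t + 1 : ℕ)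
    + f (s + 1 : ℕ) (t + 1 : ℕ)

theorem sum_mixedDiff (f : ℝ → ℝ → ℝ) (a b : ℕ) :
    ∑ s ∈ range a, ∑ t ∈ range b, mixedDiff f s t =
      f (a + 1 : ℕ) (b + 1 : ℕ) - f (a + 1 : ℕ) 1 - f 1 (b + 1 : ℕ) + f 1 1 := by
  have h1 : ∀ s, ∑ t ∈ range b, mixedDiff f s t =
      (f (s + 1 + 1 : ℕ) (b + 1 : ℕ) - f (s + 1 + 1 : ℕ) 1) -
        (f (s + 1 : ℕ) (b + 1 : ℕ) - f (s + 1 : ℕ) 1) := by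
    intro s
    have := Finset.sum_range_sub
      (fun t : ℕ => f (s + 2 : ℕ) (t + 1 : ℕ) - f (s + 1 : ℕ) (t + 1 : ℕ)) b
    simp only [zero_add, Nat.cast_one] at this
    rw [show f (s + 1 + 1 : ℕ) (b + 1 : ℕ) - f (s + 1 + 1 : ℕ) 1 -
        (f (s + 1 : ℕ) (b + 1 : ℕ) - f (s + 1 : ℕ) 1) =
        f (s + 2 : ℕ) (b + 1 : ℕ) - f (s + 1 : ℕ) (b + 1 : ℕ) -
        (f (s + 2 : ℕ) 1 - f (s + 1 : ℕ) 1) by ring, ← this]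
    refine Finset.sum_congr rfl fun t _ => ?_
    unfold mixedDiff; ring
  rw [Finset.sum_congr rfl fun s _ => h1 s,
    Finset.sum_range_sub (fun s : ℕ => f (s + 1 : ℕ) (b + 1 : ℕ) - f (s + 1 : ℕ) 1)]
  simp only [zero_add, Nat.cast_one]; ring

/-- Inverts the telescoping of `sum_mixedDiff`. The indicator lets one range, bounded by any `M`
above both arguments, serve all pairs; thresholds start at 2 because the arguments are at least 1.
-/
theorem eq_add_sum_mixedDiff (f : ℝ → ℝ → ℝ) {M x y : ℕ} (hx : 0 < x) (hy : 0 < y)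
    (hxM : x ≤ M) (hyM : y ≤ M) :
    f x y = (f x 1 - f 1 1) + f 1 y + ∑ s ∈ range M, ∑ t ∈ range M,
      mixedDiff f s t * (if s + 2 ≤ x ∧ t + 2 ≤ y then 1 else 0) := by
  obtain ⟨a, rfl⟩ : ∃ a, x = a + 1 := ⟨x - 1, by omega⟩
  obtain ⟨b, rfl⟩ : ∃ b, y = b + 1 := ⟨y - 1, by omega⟩
  have : ∑ s ∈ range M, ∑ t ∈ range M,
      mixedDiff f s t * (if s + 2 ≤ a + 1 ∧ t + 2 ≤ b + 1 then 1 else 0) =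
      ∑ s ∈ range a, ∑ t ∈ range b, mixedDiff f s t := by
    rw [← Finset.sum_subset (s₁ := range a) (s₂ := range M)]
    · refine Finset.sum_congr rfl fun s hs => ?_
      rw [← Finset.sum_subset (s₁ := range b) (s₂ := range M)]
      · refine Finset.sum_congr rfl fun t ht => ?_
        rw [mem_range] at hs ht
        rw [if_pos ⟨by omega, by omega⟩, mul_one]
      · intro t; simp only [mem_range]; omega
      · intro t _ ht
        rw [mem_range] at ht
        rw [if_neg (by omega), mul_zero]
    · intro t; simp only [mem_range]; omega
    · intro s _ hs
      rw [mem_range] at hs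
      refine Finset.sum_eq_zero fun t _ => ?_
      rw [if_neg (by omega), mul_zero]
  rw [this, sum_mixedDiff]; ring

theorem IsEscalating.mixedDiff_nonneg {f : ℝ → ℝ → ℝ} (hf : IsEscalating f) (s t : ℕ) :
    0 ≤ mixedDiff f s t := by
  have h := hf.le (s + 2 : ℕ) (s + 1 : ℕ) (t + 2 : ℕ) (t + 1 : ℕ) (by positivity)
    (by push_cast; linarith) (by positivity) (by push_cast; linarith)
  rw [hf.symm (t + 2 : ℕ) (s + 1 : ℕ) (by positivity) (by positivity)] at h
  unfold mixedDiff; linarith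

open Classical in
theorem sum_adj_left {V : Type*} [Fintype V] (G : SimpleGraph V) (φ : ℕ → ℝ) :
    (∑ u, ∑ v, if G.Adj u v then φ (G.degree u) else 0) =
      ∑ u, (G.degree u : ℝ) * φ (G.degree u) := by
  refine Finset.sum_congr rfl fun u _ => ?_
  rw [← Finset.sum_filter, Finset.sum_const, nsmul_eq_mul, ← SimpleGraph.card_neighborFinset_eq_degree,
    SimpleGraph.neighborFinset_eq_filter]

open Classical in
theorem sum_adj_right {V : Type*} [Fintype V] (G : SimpleGraph V) (φ : ℕ → ℝ) :
    (∑ u, ∑ v, if G.Adj u v then φ (G.degree v) else 0) =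
      ∑ u, (G.degree u : ℝ) * φ (G.degree u) := by
  rw [Finset.sum_comm, ← sum_adj_left]
  simp only [G.adj_comm]

open Classical in
theorem sum_indicator_eq_adjCount {V : Type*} [Fintype V] (G : SimpleGraph V) (s t : ℕ) :
    (∑ u, ∑ v, if G.Adj u v then (if s ≤ G.degree u ∧ t ≤ G.degree v then (1 : ℝ) else 0) else 0) =
      adjCount G (upperSet G s) (upperSet G t) := by
  unfold adjCount upperSet
  push_cast
  rw [Finset.sum_filter]
  refine Finset.sum_congr rfl fun u _ => ?_
  rw [Finset.sum_filter]
  split_ifs with h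
  · simp only [h, true_and]
    refine Finset.sum_congr rfl fun v _ => ?_
    split_ifs <;> rfl
  · simp [h]

-- The first two sums are functions of the degree sequence alone, so graphs in one class differ only
-- in the last sum.
open Classical in
theorem two_mul_connectivity_eq {V : Type*} [Fintype V] (G : SimpleGraph V) (f : ℝ → ℝ → ℝ)
    (hf : ∀ x y, 0 < x → 0 < y → f x y = f y x) {M : ℕ} (hM : ∀ v, G.degree v ≤ M) :
    2 * connectivity f G =
      ∑ u, (G.degree u : ℝ) * (f (G.degree u) 1 - f 1 1) + ∑ u, (G.degree u : ℝ) * f 1 (G.degree u)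
      + ∑ s ∈ range M, ∑ t ∈ range M,
        mixedDiff f s t * adjCount G (upperSet G (s + 2)) (upperSet G (t + 2)) := by
  rw [two_mul_connectivity G f hf, ← sum_adj_left G fun d => f d 1 - f 1 1,
    ← sum_adj_right G fun d => f 1 d]
  simp only [← sum_indicator_eq_adjCount, Finset.mul_sum]
  have hswap : (∑ s ∈ range M, ∑ t ∈ range M, ∑ u, ∑ v, mixedDiff f s t *
      (if G.Adj u v then (if s + 2 ≤ G.degree u ∧ t + 2 ≤ G.degree v then (1 : ℝ) else 0) else 0)) =
      ∑ u, ∑ v, ∑ s ∈ range M, ∑ t ∈ range M, mixedDiff f s t *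
      (if G.Adj u v then (if s + 2 ≤ G.degree u ∧ t + 2 ≤ G.degree v then (1 : ℝ) else 0) else 0) := by
    rw [Finset.sum_congr rfl fun s _ => Finset.sum_comm, Finset.sum_comm]
    refine Finset.sum_congr rfl fun u _ => ?_
    rw [Finset.sum_congr rfl fun s _ => Finset.sum_comm, Finset.sum_comm]
  rw [hswap, ← Finset.sum_add_distrib, ← Finset.sum_add_distrib]
  refine Finset.sum_congr rfl fun u _ => ?_
  rw [← Finset.sum_add_distrib, ← Finset.sum_add_distrib]
  refine Finset.sum_congr rfl fun v _ => ?_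
  by_cases h : G.Adj u v
  · simp only [h, if_true]
    exact eq_add_sum_mixedDiff f ((G.degree_pos_iff_exists_adj u).2 ⟨v, h⟩)
      ((G.degree_pos_iff_exists_adj v).2 ⟨u, h.symm⟩) (hM u) (hM v)
  · simp [h]

open Classical in
theorem HasDegreeSequence.sum_degree {n : ℕ} {V : Type*} [Fintype V] {π : Fin n → ℕ}
    {G : SimpleGraph V} (h : HasDegreeSequence π G) {α : Type*} [AddCommMonoid α] (φ : ℕ → α) :
    ∑ v, φ (G.degree v) = ∑ i, φ (π i) := by
  obtain ⟨v, hv⟩ := h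
  rw [← v.sum_comp]; simp only [hv]

theorem adjCount_comm {V : Type*} (G : SimpleGraph V) (A B : Finset V) :
    adjCount G A B = adjCount G B A := by
  unfold adjCount
  rw [Finset.sum_comm]
  refine Finset.sum_congr rfl fun u _ => Finset.sum_congr rfl fun v _ => ?_
  rw [G.adj_comm]

open Classical in
theorem connectivity_le {n : ℕ} {V W : Type*} [Fintype V] [Fintype W] {π : Fin n → ℕ}
    {G : SimpleGraph V} {B : SimpleGraph W} (hG : HasDegreeSequence π G)
    (hB : HasDegreeSequence π B)
    (hle : ∀ s t, t ≤ s → adjCount G (upperSet G s) (upperSet G t) ≤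
      adjCount B (upperSet B s) (upperSet B t))
    {f : ℝ → ℝ → ℝ} (hf : IsEscalating f) : connectivity f G ≤ connectivity f B := by
  -- A crude common bound on all degrees of both graphs.
  set M := ∑ i, π i with hMdef
  have hπ : ∀ i, π i ≤ M := fun i => Finset.single_le_sum (f := π) (fun _ _ => Nat.zero_le _) (mem_univ i)
  have hMG : ∀ v, G.degree v ≤ M := by
    obtain ⟨v, hv⟩ := hG
    intro x; rw [← v.apply_symm_apply x, hv]; exact hπ _
  have hMB : ∀ v, B.degree v ≤ M := by
    obtain ⟨v, hv⟩ := hB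
    intro x; rw [← v.apply_symm_apply x, hv]; exact hπ _
  have h1 := two_mul_connectivity_eq G f hf.symm hMG
  have h2 := two_mul_connectivity_eq B f hf.symm hMB
  rw [hG.sum_degree (fun d => (d : ℝ) * (f d 1 - f 1 1)),
    hG.sum_degree (fun d => (d : ℝ) * f 1 d)] at h1
  rw [hB.sum_degree (fun d => (d : ℝ) * (f d 1 - f 1 1)),
    hB.sum_degree (fun d => (d : ℝ) * f 1 d)] at h2
  have h3 : ∑ s ∈ range M, ∑ t ∈ range M,
      mixedDiff f s t * adjCount G (upperSet G (s + 2)) (upperSet G (t + 2)) ≤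
      ∑ s ∈ range M, ∑ t ∈ range M,
      mixedDiff f s t * adjCount B (upperSet B (s + 2)) (upperSet B (t + 2)) := by
    refine Finset.sum_le_sum fun s _ => Finset.sum_le_sum fun t _ =>
      mul_le_mul_of_nonneg_left ?_ (hf.mixedDiff_nonneg s t)
    rcases le_total t s with h | h
    · exact_mod_cast hle _ _ (by omega)
    · rw [adjCount_comm G, adjCount_comm B]
      exact_mod_cast hle _ _ (by omega)
  linarith

theorem IsDeEscalating.neg {f : ℝ → ℝ → ℝ} (hf : IsDeEscalating f) :
    IsEscalating fun x y => -f x y where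
  symm x y hx hy := by rw [hf.symm x y hx hy]
  le x₁ y₁ x₂ y₂ h₁ h₂ h₃ h₄ := by linarith [hf.le x₁ y₁ x₂ y₂ h₁ h₂ h₃ h₄]
  lt x₁ y₁ x₂ y₂ h₁ h₂ h₃ h₄ := by linarith [hf.lt x₁ y₁ x₂ y₂ h₁ h₂ h₃ h₄]

theorem connectivity_neg {V : Type*} [Fintype V] (f : ℝ → ℝ → ℝ) (G : SimpleGraph V) :
    connectivity (fun x y => -f x y) G = -connectivity f G := by
  simp [connectivity]

end Bicyclic

/-! ### Upper bounds in a bicyclic class -/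

namespace Bicyclic

open Finset

open Classical in
theorem adjCount_univ_right {V : Type*} [Fintype V] (G : SimpleGraph V) (A : Finset V) :
    adjCount G A univ = ∑ u ∈ A, G.degree u := by
  refine Finset.sum_congr rfl fun u _ => ?_
  rw [← Finset.sum_filter, Finset.sum_const, smul_eq_mul, mul_one,
    ← SimpleGraph.card_neighborFinset_eq_degree, SimpleGraph.neighborFinset_eq_filter]

theorem adjCount_mono {V : Type*} (G : SimpleGraph V) {A A' B B' : Finset V} (hA : A ⊆ A')
    (hB : B ⊆ B') : adjCount G A B ≤ adjCount G A' B' :=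
  (Finset.sum_le_sum_of_subset hA).trans
    (Finset.sum_le_sum fun _ _ => Finset.sum_le_sum_of_subset hB)

theorem adjCount_union_right {V : Type*} [DecidableEq V] (G : SimpleGraph V) {A B C : Finset V}
    (h : Disjoint B C) : adjCount G A (B ∪ C) = adjCount G A B + adjCount G A C := by
  unfold adjCount
  rw [← Finset.sum_add_distrib]
  exact Finset.sum_congr rfl fun u _ => Finset.sum_union h

theorem adjCount_union_left {V : Type*} [DecidableEq V] (G : SimpleGraph V) {A B C : Finset V}
    (h : Disjoint A B) : adjCount G (A ∪ B) C = adjCount G A C + adjCount G B C := by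
  rw [adjCount_comm, adjCount_union_right G h, adjCount_comm G C A, adjCount_comm G C B]

/-- With `B = A ∪ C` disjoint, the two sides differ by the non-negative number `adjCount G C C`. -/
theorem two_mul_adjCount_le {V : Type*} (G : SimpleGraph V) {A B : Finset V} (h : A ⊆ B) :
    2 * adjCount G A B ≤ adjCount G A A + adjCount G B B := by
  classical
  have hd : Disjoint A (B \ A) := disjoint_sdiff
  obtain ⟨C, hC, rfl⟩ : ∃ C, Disjoint A C ∧ B = A ∪ C := ⟨B \ A, hd, (union_sdiff_of_subset h).symm⟩
  rw [adjCount_union_left G hC, adjCount_union_right G hC, adjCount_union_right G hC,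
    adjCount_comm G C A]
  omega

theorem adjCount_self_le {V : Type*} (G : SimpleGraph V) {A B : Finset V} (h : A ⊆ B) :
    adjCount G A B ≤ #A * (#B - 1) := by
  classical
  rw [← smul_eq_mul]
  refine Finset.sum_le_card_nsmul _ _ _ fun u hu => ?_
  rw [← Finset.card_erase_of_mem (h hu), ← Finset.card_filter]
  refine Finset.card_le_card fun v hv => ?_
  rw [mem_filter] at hv
  exact mem_erase.2 ⟨hv.2.ne', hv.1⟩

theorem adjCount_insert_ge {V : Type*} [DecidableEq V] (G : SimpleGraph V) {A : Finset V} {a x : V}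
    (ha : a ∈ A) (hx : x ∉ A) (hax : G.Adj a x) :
    adjCount G A A + 2 ≤ adjCount G (insert x A) (insert x A) := by
  have hd : Disjoint A {x} := by simpa using hx
  have h1 : 1 ≤ adjCount G A {x} := by
    calc 1 = adjCount G {a} {x} := by
          unfold adjCount; rw [sum_singleton, sum_singleton, if_pos hax]
      _ ≤ _ := adjCount_mono G (by simpa using ha) subset_rfl
  rw [insert_eq, union_comm, adjCount_union_left G hd, adjCount_union_right G hd,
    adjCount_union_right G hd, adjCount_comm G {x} A]
  omega

/-- Growing `A` to the whole vertex set one vertex at a time, always across an edge leaving the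
current set, gains at least one edge per vertex, that is, two ordered pairs. -/
theorem adjCount_add_le_of_connected {V : Type*} [Fintype V] {G : SimpleGraph V}
    (hG : G.Connected) (A : Finset V) (hA : A.Nonempty) :
    adjCount G A A + 2 * Fintype.card V ≤ adjCount G univ univ + 2 * #A := by
  classical
  induction hk : Fintype.card V - #A generalizing A with
  | zero =>
    have : A = univ := by
      rw [← Finset.card_eq_iff_eq_univ]
      have := Finset.card_le_univ A
      omega
    subst this
    simp
  | succ k ih =>
    obtain ⟨y, hy⟩ : ∃ y, y ∉ A := by
      by_contra! h
      have : A = univ := Finset.eq_univ_iff_forall.2 h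
      subst this
      simp at hk
    obtain ⟨a, ha⟩ := hA
    obtain ⟨p⟩ := hG.preconnected a y
    obtain ⟨d, -, hd1, hd2⟩ := p.exists_boundary_dart (A : Set V) ha hy
    have h1 := adjCount_insert_ge G hd1 hd2 d.adj
    have h2 := card_insert_of_notMem hd2
    have h3 := ih (insert d.snd A) (insert_nonempty _ _) (by omega)
    omega

/-- The largest number of edges that `p` vertices of a bicyclic graph can span. -/
def maxEdges : ℕ → ℕ
  | 0 => 0
  | 1 => 0
  | 2 => 1
  | 3 => 3
  | p + 4 => p + 5

/-- Up to three vertices the complete graph is the limit; from four on it is connectedness, which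
lets a subset exceed its own size by at most one edge. -/
theorem adjCount_self_le_maxEdges {V : Type*} [Fintype V] {G : SimpleGraph V}
    (hG : G.Connected) (hE : adjCount G univ univ ≤ 2 * (Fintype.card V + 1)) (A : Finset V) :
    adjCount G A A ≤ 2 * maxEdges #A := by
  have h1 := adjCount_self_le G (subset_refl A)
  rcases hc : #A with _ | _ | _ | _ | p <;> rw [hc] at h1 <;> simp only [maxEdges] <;> try omega
  have := adjCount_add_le_of_connected hG A (card_pos.1 (by omega))
  omega

open Classical in
/-- A graph whose upper sets of vertices are joined by as many edges as the degrees and the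
cyclomatic number permit. -/
def AttainsBound {V : Type*} [Fintype V] (B : SimpleGraph V) : Prop :=
  ∀ s t, t ≤ s →
    adjCount B (upperSet B s) (upperSet B t) = ∑ u ∈ upperSet B s, B.degree u ∨
    (#(upperSet B s) = 1 ∧ #(upperSet B t) ≤ adjCount B (upperSet B s) (upperSet B t) + 1) ∨
    maxEdges #(upperSet B s) + maxEdges #(upperSet B t) ≤
      adjCount B (upperSet B s) (upperSet B t)

open Classical in
theorem HasDegreeSequence.card_upperSet {n : ℕ} {V : Type*} [Fintype V] {π : Fin n → ℕ}
    {G : SimpleGraph V} (h : HasDegreeSequence π G) (s : ℕ) :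
    #(upperSet G s) = #(univ.filter fun i => s ≤ π i) := by
  rw [upperSet, card_filter, card_filter]
  exact h.sum_degree fun d => if s ≤ d then 1 else 0

open Classical in
theorem HasDegreeSequence.sum_degree_upperSet {n : ℕ} {V : Type*} [Fintype V] {π : Fin n → ℕ}
    {G : SimpleGraph V} (h : HasDegreeSequence π G) (s : ℕ) :
    ∑ u ∈ upperSet G s, G.degree u = ∑ i ∈ univ.filter (fun i => s ≤ π i), π i := by
  rw [upperSet, sum_filter, sum_filter]
  exact h.sum_degree fun d => if s ≤ d then d else 0

theorem HasDegreeSequence.card_eq {n : ℕ} {V : Type*} [Fintype V] {π : Fin n → ℕ}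
    {G : SimpleGraph V} (h : HasDegreeSequence π G) : Fintype.card V = n := by
  obtain ⟨v, -⟩ := h
  rw [← Fintype.card_congr v, Fintype.card_fin]

open Classical in
theorem HasDegreeSequence.adjCount_univ {n : ℕ} {V : Type*} [Fintype V] {π : Fin n → ℕ}
    {G : SimpleGraph V} (h : HasDegreeSequence π G) : adjCount G univ univ = ∑ i, π i := by
  rw [adjCount_univ_right]
  exact h.sum_degree id

/-- Each alternative of `AttainsBound` names an upper bound valid for `G` as well, and its value
agrees for `G` and `B` because sizes and degree sums of upper sets are determined by `π`. -/
theorem adjCount_upperSet_le {n : ℕ} {V W : Type*} [Fintype V] [Fintype W] {π : Fin n → ℕ}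
    (hπ : ∑ i, π i = 2 * (n + 1))
    {G : SimpleGraph V} {B : SimpleGraph W} (hG : InGamma π G)
    (hB : HasDegreeSequence π B) (hatt : AttainsBound B) (s t : ℕ) (hst : t ≤ s) :
    adjCount G (upperSet G s) (upperSet G t) ≤ adjCount B (upperSet B s) (upperSet B t) := by
  classical
  have hsub := upperSet_subset (G := G) hst
  have hatt := hatt s t hst
  rw [hB.sum_degree_upperSet, hB.card_upperSet, hB.card_upperSet, ← hG.2.sum_degree_upperSet,
    ← hG.2.card_upperSet, ← hG.2.card_upperSet] at hatt
  rcases hatt with h | ⟨h1, h2⟩ | h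
  · rw [h, ← adjCount_univ_right]
    exact adjCount_mono G subset_rfl (subset_univ _)
  · have := adjCount_self_le G hsub
    rw [h1] at this
    omega
  · have hE : adjCount G univ univ ≤ 2 * (Fintype.card V + 1) := by
      rw [hG.2.adjCount_univ, hπ, hG.2.card_eq]
    have h1 := two_mul_adjCount_le G hsub
    have h2 := adjCount_self_le_maxEdges hG.1 hE (upperSet G s)
    have h3 := adjCount_self_le_maxEdges hG.1 hE (upperSet G t)
    omega

theorem isExtremal_of_attainsBound {n : ℕ} {V : Type u} [Fintype V] {π : Fin n → ℕ}
    (hπ : ∑ i, π i = 2 * (n + 1)) {B : SimpleGraph V} (hB : InGamma π B) (hatt : AttainsBound B)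
    (f : ℝ → ℝ → ℝ) : IsExtremal f π B := by
  refine ⟨hB, fun hf W _ G hG => ?_, fun hf W _ G hG => ?_⟩
  · exact connectivity_le hG.2 hB.2 (adjCount_upperSet_le hπ hG hB.2 hatt) hf
  · have := connectivity_le hG.2 hB.2 (adjCount_upperSet_le hπ hG hB.2 hatt) hf.neg
    rw [connectivity_neg, connectivity_neg] at this
    linarith

end Bicyclic

/-! ### Bicyclic degree sequences -/

namespace Bicyclic

open Finset

-- Discarding the vertices of degree at most one loses at most one edge for each of them.
open Classical in
theorem adjCount_univ_le_upperSet_two {V : Type*} [Fintype V] (G : SimpleGraph V) :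
    adjCount G univ univ + 2 * #(upperSet G 2) ≤
      adjCount G (upperSet G 2) (upperSet G 2) + 2 * Fintype.card V := by
  set A := upperSet G 2 with hA
  have hd : Disjoint A Aᶜ := disjoint_compl_right
  have h1 : adjCount G Aᶜ univ ≤ #Aᶜ := by
    rw [adjCount_univ_right, ← mul_one #Aᶜ, ← smul_eq_mul]
    refine Finset.sum_le_card_nsmul _ _ _ fun u hu => ?_
    rw [mem_compl, hA, mem_upperSet] at hu
    omega
  have h2 : adjCount G univ univ = adjCount G A univ + adjCount G Aᶜ univ := by
    rw [← adjCount_union_left G hd, union_compl]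
  have h3 : adjCount G A univ = adjCount G A A + adjCount G A Aᶜ := by
    rw [← adjCount_union_right G hd, union_compl]
  have h4 : adjCount G A Aᶜ ≤ adjCount G Aᶜ univ := by
    rw [adjCount_comm]; exact adjCount_mono G subset_rfl (subset_univ _)
  have h5 := card_add_card_compl A
  omega

theorem IsBicyclic.adjCount_univ {V : Type*} [Fintype V] {G : SimpleGraph V} (h : IsBicyclic G) :
    adjCount G univ univ = 2 * (Fintype.card V + 1) := by
  classical
  rw [adjCount_univ_right, G.sum_degrees_eq_twice_card_edges, ← h.2, ← SimpleGraph.coe_edgeFinset,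
    Set.ncard_coe_finset]

variable {n : ℕ} {π : Fin n → ℕ}

theorem IsBicyclicDegreeSequence.sum_eq (h : IsBicyclicDegreeSequence π) :
    ∑ i, π i = 2 * (n + 1) := by
  obtain ⟨-, G, hG, hd⟩ := h
  rw [← hd.adjCount_univ, hG.adjCount_univ, Fintype.card_fin]

/-- The a vertices of degree at least 2 span at least a + 1 edges, which is more than a(a - 1)/2
unless a ≥ 4. -/
theorem IsBicyclicDegreeSequence.four_le_card (h : IsBicyclicDegreeSequence π) :
    4 ≤ #(univ.filter fun i => 2 ≤ π i) := by
  obtain ⟨-, G, hG, hd⟩ := h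
  have h1 := hG.adjCount_univ
  have h2 := adjCount_univ_le_upperSet_two G
  have h3 := adjCount_self_le G (subset_refl (upperSet G 2))
  rw [← hd.card_upperSet]
  by_contra! hlt
  interval_cases #(upperSet G 2) <;> omega

theorem IsBicyclicDegreeSequence.four_le (h : IsBicyclicDegreeSequence π) : 4 ≤ n := by
  simpa using h.four_le_card.trans (card_le_univ _)

theorem IsBicyclicDegreeSequence.pos (h : IsBicyclicDegreeSequence π) (i : Fin n) : 1 ≤ π i := by
  classical
  have hn := h.four_le
  obtain ⟨-, G, hG, v, hv⟩ := h
  have : Nontrivial (Fin n) := Fin.nontrivial_iff_two_le.2 (by omega)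
  rw [← hv]
  exact hG.1.preconnected.degree_pos_of_nontrivial _

theorem IsBicyclicDegreeSequence.two_le (h : IsBicyclicDegreeSequence π) (i : Fin n)
    (hi : i.val < 4) : 2 ≤ π i := by
  by_contra! hlt
  have h1 : (univ.filter fun j => 2 ≤ π j) ⊆ Finset.Iio i := by
    intro j hj
    simp only [mem_filter, mem_univ, true_and] at hj
    rw [Finset.mem_Iio]
    by_contra! hij
    have := h.1 hij
    omega
  have h2 := card_le_card h1
  rw [Fin.card_Iio] at h2
  have := h.four_le_card
  omega

theorem IsBicyclicDegreeSequence.cases [NeZero n] (h : IsBicyclicDegreeSequence π) :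
    (π 1 ≤ π 0 ∧ 3 ≤ π 1 ∧ π ⊤ = 1) ∨ (5 ≤ π 0 ∧ π 1 = 2 ∧ π ⊤ = 1) ∨
    (∀ i, π i = if i = 0 then 4 else 2) ∨ (∀ i, π i = if i = 0 ∨ i = 1 then 3 else 2) := by
  have hn := h.four_le
  have h1v : (1 : Fin n).val = 1 := by
    rw [Fin.val_one', Nat.mod_eq_of_lt (by omega)]
  have h0v : (0 : Fin n).val = 0 := rfl
  have h01 : (0 : Fin n) ≠ 1 := by intro e; have := congrArg Fin.val e; omega
  have h1le : ∀ i : Fin n, i ≠ 0 → π i ≤ π 1 := fun i hi => h.1 (by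
    rw [Fin.le_def, h1v]
    have : i.val ≠ 0 := fun e => hi (Fin.ext e)
    omega)
  have h10 : π 1 ≤ π 0 := h.1 (Fin.zero_le _)
  have h12 : 2 ≤ π 1 := h.two_le 1 (by omega)
  have hsum := h.sum_eq
  have htop : ∀ i, π ⊤ ≤ π i := fun i => h.1 le_top
  have htpos := h.pos ⊤
  have hsplit : π 0 + ∑ i ∈ univ.erase 0, π i = 2 * (n + 1) := by
    rw [← hsum, Finset.add_sum_erase _ _ (mem_univ _)]
  have hcard : #((univ : Finset (Fin n)).erase 0) = n - 1 := by
    rw [card_erase_of_mem (mem_univ _), card_fin]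
  by_cases ht : π ⊤ = 1
  · by_cases h3 : 3 ≤ π 1
    · exact Or.inl ⟨h10, h3, ht⟩
    · refine Or.inr (Or.inl ⟨?_, by omega, ht⟩)
      have ht0 : (⊤ : Fin n) ≠ 0 := by
        rintro e; rw [e] at ht; omega
      -- All entries but the first are at most 2 and the last is smaller, so the first must exceed 4
      -- to reach the total 2(n + 1).
      have : ∑ i ∈ univ.erase 0, π i < ∑ i ∈ (univ : Finset (Fin n)).erase 0, 2 := by
        refine Finset.sum_lt_sum (fun i hi => ?_) ⟨⊤, mem_erase.2 ⟨ht0, mem_univ _⟩, by omega⟩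
        have := h1le i (ne_of_mem_erase hi)
        omega
      rw [sum_const, hcard, smul_eq_mul] at this
      omega
  -- Without pendant vertices the total excess over 2 is exactly 2: it sits on one entry or is
  -- shared by two.
  · have he : ∑ i, (π i - 2) = 2 := by
      have : ∑ i, (π i - 2) + ∑ i : Fin n, 2 = ∑ i, π i := by
        rw [← sum_add_distrib]
        refine sum_congr rfl fun i _ => ?_
        have := htop i
        omega
      rw [sum_const, card_fin, smul_eq_mul] at this
      omega
    refine Or.inr (Or.inr ?_)
    by_cases h3 : 3 ≤ π 1
    · right
      have h2 : ∑ i ∈ {0, 1}, (π i - 2) ≤ 2 :=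
        (sum_le_sum_of_subset (subset_univ _)).trans he.le
      rw [sum_pair h01] at h2
      intro i
      split_ifs with hi
      · rcases hi with rfl | rfl <;> omega
      · rw [not_or] at hi
        have h2' : ∑ j ∈ insert i {0, 1}, (π j - 2) ≤ 2 :=
          (sum_le_sum_of_subset (subset_univ _)).trans he.le
        rw [sum_insert (by simpa using hi), sum_pair h01] at h2'
        have := htop i
        omega
    · left
      have h2 : ∀ i, i ≠ 0 → π i = 2 := fun i hi => by
        have := h1le i hi
        have := htop i
        omega
      intro i
      split_ifs with hi
      · subst hi
        rw [Finset.sum_eq_single 0 (fun j _ hj => by rw [h2 j hj]; rfl) (by simp)] at he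
        omega
      · exact h2 i hi

end Bicyclic

/-! ### Graphs given by a map to preceding neighbours -/

namespace Bicyclic

open Finset

/-! ### Invariance under isomorphism. -/

open Classical in
theorem map_upperSet {V W : Type*} [Fintype V] [Fintype W] {G : SimpleGraph V}
    {H : SimpleGraph W} (e : G ≃g H) (s : ℕ) :
    upperSet H s = (upperSet G s).map e.toEquiv.toEmbedding := by
  ext x
  obtain ⟨y, rfl⟩ := e.surjective x
  rw [mem_upperSet, e.degree_eq, ← mem_upperSet]
  exact (mem_map' e.toEquiv.toEmbedding).symm

open Classical in
theorem adjCount_map {V W : Type*} {G : SimpleGraph V}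
    {H : SimpleGraph W} (e : G ≃g H) (A B : Finset V) :
    adjCount H (A.map e.toEquiv.toEmbedding) (B.map e.toEquiv.toEmbedding) = adjCount G A B := by
  unfold adjCount
  rw [sum_map]
  refine sum_congr rfl fun u _ => ?_
  rw [sum_map]
  refine sum_congr rfl fun v _ => ?_
  have : H.Adj (e.toEquiv.toEmbedding u) (e.toEquiv.toEmbedding v) ↔ G.Adj u v := e.map_adj_iff
  simp only [this]

theorem AttainsBound.of_iso {V W : Type*} [Fintype V] [Fintype W] {G : SimpleGraph V}
    {H : SimpleGraph W} (e : G ≃g H) (h : AttainsBound G) : AttainsBound H := by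
  classical
  intro s t hst
  have := h s t hst
  rw [← adjCount_univ_right] at this ⊢
  have hu : (univ : Finset W) = (univ : Finset V).map e.toEquiv.toEmbedding := by simp
  rw [hu, map_upperSet e, map_upperSet e, adjCount_map e, card_map, card_map, adjCount_map e]
  exact this

theorem InGamma.of_iso {n : ℕ} {π : Fin n → ℕ} {V W : Type*} [Fintype V] [Fintype W]
    {G : SimpleGraph V} {H : SimpleGraph W} (e : G ≃g H) (h : InGamma π G) : InGamma π H := by
  classical
  obtain ⟨hc, v, hv⟩ := h
  refine ⟨e.connected_iff.1 hc, v.trans e.toEquiv, fun i => ?_⟩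
  rw [← hv]
  exact e.degree_eq _

/-! ### Initial segments and parent maps. -/

/-- The first `p` elements of `Fin n`. -/
def initSeg (n p : ℕ) : Finset (Fin n) := univ.filter fun i => i.val < p

theorem mem_initSeg {n p : ℕ} {i : Fin n} : i ∈ initSeg n p ↔ i.val < p := by simp [initSeg]

theorem sum_initSeg {n p : ℕ} (hp : p ≤ n) (φ : ℕ → ℕ) :
    ∑ i ∈ initSeg n p, φ i.val = ∑ k ∈ range p, φ k := by
  refine sum_bij (fun i _ => i.val) ?_ ?_ ?_ ?_
  · intro i hi; rw [mem_initSeg] at hi; exact mem_range.2 hi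
  · intro i _ j _ h; exact Fin.ext h
  · intro k hk
    rw [mem_range] at hk
    exact ⟨⟨k, by omega⟩, mem_initSeg.2 hk, rfl⟩
  · intros; rfl

theorem card_initSeg {n p : ℕ} (hp : p ≤ n) : #(initSeg n p) = p := by
  rw [card_eq_sum_ones, sum_initSeg hp fun _ => 1]; simp

theorem exists_eq_initSeg {n : ℕ} (S : Finset (Fin n)) (hS : ∀ i j, i ≤ j → j ∈ S → i ∈ S) :
    ∃ p ≤ n, S = initSeg n p := by
  have hex : ∃ p, ∀ i ∈ S, i.val < p := ⟨n, fun i _ => i.2⟩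
  classical
  refine ⟨Nat.find hex, Nat.find_min' hex fun i _ => i.2, ?_⟩
  ext i
  rw [mem_initSeg]
  refine ⟨Nat.find_spec hex i, fun hi => ?_⟩
  have := Nat.find_min hex hi
  push Not at this
  obtain ⟨j, hj, hij⟩ := this
  exact hS i j hij hj

/-- The number of edges from a vertex to its predecessors in the ordering of a bicyclic graph
starting with two triangles. -/
def backDegree : ℕ → ℕ
  | 0 => 0
  | 1 => 1
  | 2 => 2
  | 3 => 2
  | _ + 4 => 1

theorem sum_backDegree (p : ℕ) : ∑ k ∈ range p, backDegree k = maxEdges p := by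
  rcases p with _ | _ | _ | _ | p
  iterate 4 rfl
  induction p with
  | zero => rfl
  | succ p ih => rw [sum_range_succ, ih]; rfl

/-- The first four vertices span two triangles with common edge `v₁v₂`, and `par` selects for each
later vertex a neighbour preceding it. -/
structure IsParentMap {n : ℕ} (H : SimpleGraph (Fin n)) (par : Fin n → Fin n) : Prop where
  base : ∀ i j : Fin n, i < j → j.val < 4 → i.val < 2 → H.Adj i j
  lt : ∀ j : Fin n, 4 ≤ j.val → par j < j
  adj : ∀ j : Fin n, 4 ≤ j.val → H.Adj (par j) j

variable {n : ℕ} {H : SimpleGraph (Fin n)} {par : Fin n → Fin n}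

-- The predecessors found lie in the first `p` vertices already: `2 ≤ p` covers the vertices `0` and
-- `1`, and the hypothesis on `par` covers the parents.
open Classical in
theorem IsParentMap.backDegree_le (h : IsParentMap H par) {p : ℕ} (hp : 2 ≤ p) (j : Fin n)
    (hj : 4 ≤ j.val → (par j).val < p) :
    backDegree j.val ≤ #((initSeg n p).filter fun i => i < j ∧ H.Adj i j) := by
  obtain ⟨j, hjn⟩ := j
  have two : 2 ≤ j → j < 4 →
      2 ≤ #((initSeg n p).filter fun i => i < ⟨j, hjn⟩ ∧ H.Adj i ⟨j, hjn⟩) := by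
    intro h2 h4
    have hne : (⟨0, by omega⟩ : Fin n) ≠ ⟨1, by omega⟩ := by simp
    rw [← card_pair hne]
    refine card_le_card fun i hi => ?_
    rw [mem_insert, mem_singleton] at hi
    have hi1 : i.val ≤ 1 := by rcases hi with rfl | rfl <;> simp
    have hlt : i < ⟨j, hjn⟩ := by rw [Fin.lt_def]; simp only; omega
    exact mem_filter.2 ⟨mem_initSeg.2 (by omega), hlt, h.base _ _ hlt h4 (by omega)⟩
  rcases j with _ | _ | _ | _ | j
  · exact Nat.zero_le _
  · refine card_pos.2 ⟨⟨0, by omega⟩, ?_⟩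
    exact mem_filter.2 ⟨mem_initSeg.2 (by simp only; omega), by simp [Fin.lt_def],
      h.base _ _ (by simp [Fin.lt_def]) (by simp) (by simp)⟩
  · exact two (by omega) (by omega)
  · exact two (by omega) (by omega)
  · refine card_pos.2 ⟨par ⟨j + 4, hjn⟩, ?_⟩
    exact mem_filter.2 ⟨mem_initSeg.2 (hj (by simp)), h.lt _ (by simp), h.adj _ (by simp)⟩

-- Each adjacent ordered pair is charged to whichever of its two vertices comes later.
open Classical in
theorem adjCount_initSeg (H : SimpleGraph (Fin n)) {p q : ℕ} :
    adjCount H (initSeg n p) (initSeg n q) =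
      ∑ j ∈ initSeg n p, #((initSeg n q).filter fun i => i < j ∧ H.Adj i j) +
      ∑ j ∈ initSeg n q, #((initSeg n p).filter fun i => i < j ∧ H.Adj i j) := by
  simp only [card_filter]
  rw [sum_comm (s := initSeg n q), ← sum_add_distrib]
  refine sum_congr rfl fun u _ => ?_
  rw [← sum_add_distrib]
  refine sum_congr rfl fun v _ => ?_
  by_cases h : H.Adj u v
  · rcases lt_or_gt_of_ne h.ne with huv | huv
    · simp [h, h.symm, huv, huv.not_gt]
    · simp [h, h.symm, huv, huv.not_gt]
  · have h' : ¬ H.Adj v u := fun e => h e.symm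
    simp [h, h']

theorem IsParentMap.maxEdges_add_le (h : IsParentMap H par) {p q : ℕ} (hp : 2 ≤ p) (hpq : p ≤ q)
    (hq : q ≤ n) (hpar : ∀ j : Fin n, 4 ≤ j.val → j.val < q → (par j).val < p) :
    maxEdges p + maxEdges q ≤ adjCount H (initSeg n p) (initSeg n q) := by
  classical
  rw [adjCount_initSeg, ← sum_backDegree, ← sum_backDegree, ← sum_initSeg (hpq.trans hq),
    ← sum_initSeg hq]
  refine add_le_add (sum_le_sum fun j hj => ?_) (sum_le_sum fun j hj => ?_)
  · rw [mem_initSeg] at hj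
    refine h.backDegree_le (hp.trans hpq) j fun h4 => ?_
    have := h.lt j h4
    rw [Fin.lt_def] at this
    omega
  · exact h.backDegree_le hp j fun h4 => hpar j h4 (mem_initSeg.1 hj)

-- The termwise lower bounds already add up to the total number of edges, so each is an equality.
-- Consequently the parent is the only earlier neighbour of a vertex from the fifth on.
open Classical in
theorem IsParentMap.card_back_eq (h : IsParentMap H par) (hn : 2 ≤ n)
    (hE : adjCount H univ univ = 2 * maxEdges n) (j : Fin n) :
    #(univ.filter fun i => i < j ∧ H.Adj i j) = backDegree j.val := by
  have hu : initSeg n n = univ := by ext i; simp [mem_initSeg]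
  have h1 := adjCount_initSeg H (p := n) (q := n)
  rw [hu, hE] at h1
  have h2 : ∑ j : Fin n, backDegree j.val =
      ∑ j, #(univ.filter fun i => i < j ∧ H.Adj i j) := by
    rw [← hu, sum_initSeg le_rfl, sum_backDegree, hu]; omega
  have h3 : ∀ j ∈ univ, backDegree j.val ≤ #(univ.filter fun i => i < j ∧ H.Adj i j) := fun j _ => by
    have := h.backDegree_le hn j fun _ => (par j).2
    rwa [hu] at this
  exact ((sum_eq_sum_iff_of_le h3).1 h2 j (mem_univ j)).symm

theorem IsParentMap.eq_par (h : IsParentMap H par) (hn : 2 ≤ n)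
    (hE : adjCount H univ univ = 2 * maxEdges n) {i j : Fin n} (hij : i < j) (hadj : H.Adj i j)
    (hj : 4 ≤ j.val) : i = par j := by
  classical
  have h1 := h.card_back_eq hn hE j
  rw [show backDegree j.val = 1 by obtain ⟨k, hk⟩ := Nat.exists_eq_add_of_le' hj; rw [hk]; rfl,
    card_eq_one] at h1
  obtain ⟨a, ha⟩ := h1
  have hi : i ∈ ({a} : Finset (Fin n)) := ha ▸ mem_filter.2 ⟨mem_univ _, hij, hadj⟩
  have hp : par j ∈ ({a} : Finset (Fin n)) := ha ▸ mem_filter.2 ⟨mem_univ _, h.lt j hj, h.adj j hj⟩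
  rw [mem_singleton] at hi hp
  rw [hi, hp]

open Classical in
theorem IsParentMap.attainsBound (h : IsParentMap H par) (hn : 2 ≤ n)
    (hE : adjCount H univ univ = 2 * maxEdges n)
    (hanti : ∀ i j, i ≤ j → H.degree j ≤ H.degree i)
    (hmono : ∀ i j : Fin n, 4 ≤ i.val → i ≤ j → par i ≤ par j) : AttainsBound H := by
  intro s t hst
  have hlow : ∀ s, ∃ p ≤ n, upperSet H s = initSeg n p := fun s => by
    refine exists_eq_initSeg _ fun i j hij hj => ?_
    rw [mem_upperSet] at *
    exact hj.trans (hanti i j hij)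
  obtain ⟨p, hp, hsp⟩ := hlow s
  obtain ⟨q, hq, htq⟩ := hlow t
  have hpq : p ≤ q := by
    rw [← card_initSeg hp, ← card_initSeg hq, ← hsp, ← htq]
    exact card_le_card (upperSet_subset hst)
  rw [hsp, htq, card_initSeg hp, card_initSeg hq]
  by_cases hpar : ∀ j : Fin n, 4 ≤ j.val → j.val < q → (par j).val < p
  · rcases p with _ | _ | p
    · left; simp [initSeg, adjCount]
    -- For `p = 1` all parents in question are the first vertex, which is thus adjacent to every
    -- other vertex of the longer segment.
    · refine Or.inr (Or.inl ⟨rfl, ?_⟩)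
      have h0 : (⟨0, by omega⟩ : Fin n) ∈ initSeg n (0 + 1) := mem_initSeg.2 (by simp)
      have h1 : initSeg n q ⊆ insert ⟨0, by omega⟩
          ((initSeg n q).filter fun j => H.Adj ⟨0, by omega⟩ j) := by
        intro j hj
        rw [mem_insert, mem_filter]
        by_cases hj0 : j.val = 0
        · left; exact Fin.ext hj0
        · right
          refine ⟨hj, ?_⟩
          by_cases hj4 : 4 ≤ j.val
          · have := hpar j hj4 (mem_initSeg.1 hj)
            have hp0 : par j = ⟨0, by omega⟩ := Fin.ext (by simp only; omega)
            rw [← hp0]; exact h.adj j hj4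
          · exact h.base _ _ (by rw [Fin.lt_def]; simp only; omega) (by omega) (by simp)
      have h2 := (card_le_card h1).trans (card_insert_le _ _)
      rw [card_initSeg hq, card_filter] at h2
      have h3 : adjCount H {⟨0, by omega⟩} (initSeg n q) ≤
          adjCount H (initSeg n (0 + 1)) (initSeg n q) :=
        adjCount_mono H (by simpa using h0) subset_rfl
      rw [adjCount, sum_singleton] at h3
      omega
    · exact Or.inr (Or.inr (h.maxEdges_add_le (by omega) hpq hq hpar))
  · left
    -- Some vertex before `q` has its parent at `p` or later. By monotonicity so do all vertices
    -- from `q` on, hence none of them is adjacent to the first `p` vertices.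
    push Not at hpar
    obtain ⟨j, hj4, hjq, hjp⟩ := hpar
    rw [← adjCount_univ_right]
    refine sum_congr rfl fun i hi => ?_
    refine sum_subset (subset_univ _) fun k _ hk => if_neg fun hadj => ?_
    rw [mem_initSeg] at hi hk
    have hik : i < k := by rw [Fin.lt_def]; omega
    have := h.eq_par hn hE hik hadj (by omega)
    have hm := hmono j k hj4 (by rw [Fin.le_def]; omega)
    rw [← this, Fin.le_def] at hm
    omega

end Bicyclic

/-! ### BFS-graphs over two triangles sharing an edge -/

namespace Bicyclic

open Finset

variable {n : ℕ} {π : Fin n → ℕ}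

theorem exists_adj_dist_succ {V : Type*} {G : SimpleGraph V} (hG : G.Connected) {r x : V}
    (hx : x ≠ r) : ∃ y, G.Adj y x ∧ G.dist r x = G.dist r y + 1 := by
  obtain ⟨p, hp⟩ := hG.exists_walk_length_eq_dist x r
  cases p with
  | nil => exact absurd rfl hx
  | @cons _ y _ hxy p =>
    refine ⟨y, hxy.symm, ?_⟩
    rw [SimpleGraph.Walk.length_cons, SimpleGraph.dist_comm] at hp
    have h1 := SimpleGraph.dist_le p
    rw [SimpleGraph.dist_comm] at h1
    have h2 := hG.dist_triangle (u := r) (v := y) (w := x)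
    rw [SimpleGraph.dist_eq_one_iff_adj.2 hxy.symm] at h2
    omega

-- A neighbour one level closer to the root serves as parent; the BFS axioms on heights and on
-- children make this parent map decreasing below each vertex and monotone.
open Classical in
theorem IsBM₁.attainsBound [NeZero n] {V : Type*} [Fintype V] {B : SimpleGraph V}
    (hn : 4 ≤ n) (hsum : ∑ i, π i = 2 * (n + 1)) (h : IsBM₁ π B) :
    InGamma π B ∧ AttainsBound B := by
  obtain ⟨v, hdeg, hbfs, φ, h0, h1, h2, h3⟩ := h
  have hseq : HasDegreeSequence π B := ⟨v, hdeg⟩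
  refine ⟨⟨hbfs.connected, hseq⟩, ?_⟩
  let e : B.comap v ≃g B := SimpleGraph.Iso.comap v B
  refine AttainsBound.of_iso e ?_
  have hv0 : (0 : Fin n).val = 0 := rfl
  have hv1 : (1 : Fin n).val = 1 := Nat.mod_eq_of_lt (show 1 < n by omega)
  have hv2 : (2 : Fin n).val = 2 := Nat.mod_eq_of_lt (show 2 < n by omega)
  have hv3 : (3 : Fin n).val = 3 := Nat.mod_eq_of_lt (show 3 < n by omega)
  have hbase : ∀ i j : Fin 4, B₁.Adj i j → B.Adj (φ i : V) (φ j : V) := fun i j hij =>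
    φ.map_adj_iff.2 hij
  have hpar : ∀ j : Fin n, ∃ i, 4 ≤ j.val → B.Adj (v i) (v j) ∧
      B.dist (v 0) (v j) = B.dist (v 0) (v i) + 1 := by
    intro j
    by_cases hj : 4 ≤ j.val
    · obtain ⟨y, hy⟩ := exists_adj_dist_succ hbfs.connected (r := v 0) (x := v j)
        (fun e => by
          have := congrArg Fin.val (v.injective e)
          omega)
      exact ⟨v.symm y, fun _ => by simpa using hy⟩
    · exact ⟨0, fun h => absurd h hj⟩
  choose par hpar using hpar
  have hP : IsParentMap (B.comap v) par := by
    refine ⟨fun i j hij hj hi => ?_, fun j hj => ?_, fun j hj => (hpar j hj).1⟩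
    · change B.Adj (v i) (v j)
      rw [Fin.lt_def] at hij
      have hi' : i = 0 ∨ i = 1 := by
        rcases Nat.lt_or_ge i.val 1 with h | h
        · left; exact Fin.ext (by omega)
        · right; exact Fin.ext (by omega)
      have hj' : j = 1 ∨ j = 2 ∨ j = 3 := by
        rcases Nat.lt_or_ge j.val 2 with h | h
        · left; exact Fin.ext (by omega)
        · rcases Nat.lt_or_ge j.val 3 with h | h
          · right; left; exact Fin.ext (by omega)
          · right; right; exact Fin.ext (by omega)
      rcases hi' with rfl | rfl <;> rcases hj' with rfl | rfl | rfl
      · rw [← h0, ← h1]; exact hbase _ _ (by simp [B₁])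
      · rw [← h0, ← h2]; exact hbase _ _ (by simp [B₁])
      · rw [← h0, ← h3]; exact hbase _ _ (by simp [B₁])
      · omega
      · rw [← h1, ← h2]; exact hbase _ _ (by simp [B₁])
      · rw [← h1, ← h3]; exact hbase _ _ (by simp [B₁])
    · by_contra! hle
      have h4 := hbfs.height_mono j (par j) hle
      have h5 := (hpar j hj).2
      omega
  have hE : adjCount (B.comap v) univ univ = 2 * maxEdges n := by
    have : HasDegreeSequence π (B.comap v) := ⟨Equiv.refl _, fun i => by
      rw [← hdeg]; exact (e.degree_eq i).symm⟩
    rw [this.adjCount_univ, hsum]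
    obtain ⟨m, rfl⟩ := Nat.exists_eq_add_of_le' hn
    rfl
  refine hP.attainsBound (by omega) hE (fun i j hij => ?_) fun i j hi hij => ?_
  · rw [← e.degree_eq, ← e.degree_eq]; exact hbfs.degree_anti i j hij
  -- If the parents came in the wrong order, monotone heights would force both parents onto one
  -- level. Uniqueness of earlier neighbours supplies the two non-adjacencies, and the children
  -- axiom then contradicts `i ≤ j`.
  · by_contra! hlt
    rcases hij.eq_or_lt with rfl | hij'
    · exact lt_irrefl _ hlt
    have hj : 4 ≤ j.val := by rw [Fin.le_def] at hij; omega
    have hh1 := hbfs.height_mono i j hij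
    have hh2 := hbfs.height_mono _ _ hlt.le
    obtain ⟨hai, hdi⟩ := hpar i hi
    obtain ⟨haj, hdj⟩ := hpar j hj
    have hn1 : ¬ B.Adj (v (par i)) (v j) := fun hadj =>
      hlt.ne' (hP.eq_par (by omega) hE ((hP.lt i hi).trans hij') hadj hj)
    have hn2 : ¬ B.Adj (v (par j)) (v i) := fun hadj =>
      hlt.ne (hP.eq_par (by omega) hE (hlt.trans (hP.lt i hi)) hadj hi)
    exact (hbfs.children (par j) (par i) j i haj hn1 hai hn2 (by omega) hdj (by omega) hlt).not_ge hij

end Bicyclic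

/-! ### Two cycles sharing a vertex or an edge -/

namespace Bicyclic

open Finset

variable {n : ℕ} {π : Fin n → ℕ}

open Classical in
theorem degree_eq_card {V : Type*} [Fintype V] (G : SimpleGraph V) (x : V) (S : Finset V)
    (h : ∀ y, G.Adj x y ↔ y ∈ S) : G.degree x = #S := by
  rw [← SimpleGraph.card_neighborFinset_eq_degree]
  congr 1
  ext y
  rw [SimpleGraph.mem_neighborFinset, h]

theorem connected_of_exists_adj_lt [NeZero n] (G : SimpleGraph (Fin n))
    (h : ∀ j : Fin n, j.val ≠ 0 → ∃ i < j, G.Adj i j) : G.Connected := by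
  have key : ∀ k, ∀ j : Fin n, j.val = k → G.Reachable 0 j := by
    intro k
    induction k using Nat.strong_induction_on with
    | _ k ih =>
      intro j hj
      by_cases hj0 : j.val = 0
      · rw [show j = 0 from Fin.ext hj0]
      · obtain ⟨i, hij, hadj⟩ := h j hj0
        exact (ih i.val (by rw [Fin.lt_def] at hij; omega) i rfl).trans hadj.reachable
  exact (SimpleGraph.connected_iff_exists_forall_reachable _).2 ⟨0, fun j => key _ j rfl⟩

theorem B₃_connected [NeZero n] {p : ℕ} (hp : 3 ≤ p) : (B₃ n p).Connected := by
  refine connected_of_exists_adj_lt _ fun j hj => ?_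
  by_cases hjp : j.val = p
  · refine ⟨⟨0, by omega⟩, by rw [Fin.lt_def]; simp only; omega, ?_⟩
    simp only [B₃, SimpleGraph.fromRel_adj, ne_eq, Fin.ext_iff]
    simp only [true_and]; omega
  · refine ⟨⟨j.val - 1, by omega⟩, by rw [Fin.lt_def]; simp only; omega, ?_⟩
    simp only [B₃, SimpleGraph.fromRel_adj, ne_eq, Fin.ext_iff]
    omega

open Classical in
theorem B₃_degree {p : ℕ} (hp : 3 ≤ p) (hpn : p + 2 ≤ n) (i : Fin n) :
    (B₃ n p).degree i = if i.val = 0 then 4 else 2 := by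
  split_ifs with hi
  · rw [degree_eq_card _ _ {⟨1, by omega⟩, ⟨p - 1, by omega⟩, ⟨p, by omega⟩, ⟨n - 1, by omega⟩}]
    · repeat rw [card_insert_of_notMem]
      · simp
      all_goals simp only [mem_insert, mem_singleton, Fin.ext_iff]; omega
    · intro j
      simp only [B₃, SimpleGraph.fromRel_adj, ne_eq, Fin.ext_iff, mem_insert, mem_singleton]
      omega
  -- The two neighbours along the cycle: the second cycle restarts at `p` from vertex `0`, and both
  -- cycles close up at `0`, from `p - 1` and from `n - 1`.
  · rw [degree_eq_card _ _ {⟨if i.val = p then 0 else i.val - 1, by split_ifs <;> omega⟩,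
      ⟨if i.val + 1 = p ∨ i.val + 1 = n then 0 else i.val + 1, by split_ifs <;> omega⟩}]
    · rw [card_pair]
      simp only [ne_eq, Fin.ext_iff]
      split_ifs <;> first | omega | simp
    · intro j
      simp only [B₃, SimpleGraph.fromRel_adj, ne_eq, Fin.ext_iff, mem_insert, mem_singleton]
      split_ifs <;> omega

theorem B₅_connected [NeZero n] (p : ℕ) : (B₅ n p).Connected := by
  refine connected_of_exists_adj_lt _ fun j hj => ?_
  refine ⟨⟨j.val - 1, by omega⟩, by rw [Fin.lt_def]; simp only; omega, ?_⟩
  simp only [B₅, SimpleGraph.fromRel_adj, ne_eq, Fin.ext_iff]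
  omega

open Classical in
theorem B₅_degree {p : ℕ} (hp : 3 ≤ p) (hpn : p + 1 ≤ n) (i : Fin n) :
    (B₅ n p).degree i = if i.val = 0 ∨ i.val = p - 1 then 3 else 2 := by
  by_cases hi : i.val = 0
  · rw [if_pos (Or.inl hi),
      degree_eq_card _ _ {⟨1, by omega⟩, ⟨p - 1, by omega⟩, ⟨n - 1, by omega⟩}]
    · repeat rw [card_insert_of_notMem]
      · simp
      all_goals simp only [mem_insert, mem_singleton, Fin.ext_iff]; omega
    · intro j
      simp only [B₅, SimpleGraph.fromRel_adj, ne_eq, Fin.ext_iff, mem_insert, mem_singleton]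
      omega
  by_cases hip : i.val = p - 1
  · rw [if_pos (Or.inr hip),
      degree_eq_card _ _ {⟨p - 2, by omega⟩, ⟨p, by omega⟩, ⟨0, by omega⟩}]
    · repeat rw [card_insert_of_notMem]
      · simp
      all_goals simp only [mem_insert, mem_singleton, Fin.ext_iff]; omega
    · intro j
      simp only [B₅, SimpleGraph.fromRel_adj, ne_eq, Fin.ext_iff, mem_insert, mem_singleton]
      omega
  · rw [if_neg (by omega), degree_eq_card _ _ {⟨i.val - 1, by omega⟩,
      ⟨if i.val + 1 = n then 0 else i.val + 1, by split_ifs <;> omega⟩}]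
    · rw [card_pair]
      simp only [ne_eq, Fin.ext_iff]
      split_ifs <;> omega
    · intro j
      simp only [B₅, SimpleGraph.fromRel_adj, ne_eq, Fin.ext_iff, mem_insert, mem_singleton]
      split_ifs <;> omega

-- With minimum degree 2, any threshold `t ≤ 2` has the whole vertex set as upper set, and the
-- degree sum is attained trivially.
open Classical in
theorem attainsBound_of_upperSet_three {V : Type*} [Fintype V] {G : SimpleGraph V}
    (hdeg : ∀ v, 2 ≤ G.degree v)
    (h : ∀ s t, 3 ≤ t → t ≤ s → (upperSet G s).Nonempty →
      (#(upperSet G s) = 1 ∧ #(upperSet G t) ≤ 1) ∨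
      maxEdges #(upperSet G s) + maxEdges #(upperSet G t) ≤
        adjCount G (upperSet G s) (upperSet G t)) : AttainsBound G := by
  intro s t hst
  by_cases ht : 3 ≤ t
  · rcases (upperSet G s).eq_empty_or_nonempty with he | he
    · left; simp [he, adjCount]
    · right
      rcases h s t ht hst he with ⟨h1, h2⟩ | h1
      · exact Or.inl ⟨h1, by omega⟩
      · exact Or.inr h1
  · left
    have : upperSet G t = univ := by
      ext v
      simp only [mem_upperSet, mem_univ, iff_true]
      exact le_trans (by omega) (hdeg v)
    rw [this, adjCount_univ_right]

theorem B₃_inGamma [NeZero n] (hπ : ∀ i, π i = if i = 0 then 4 else 2) {p : ℕ} (hp : 3 ≤ p)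
    (hpn : p + 2 ≤ n) : InGamma π (B₃ n p) := by
  refine ⟨B₃_connected hp, Equiv.refl _, fun i => ?_⟩
  rw [Equiv.refl_apply, B₃_degree hp hpn, hπ]
  simp only [Fin.ext_iff, Fin.val_zero]

theorem B₃_attainsBound {p : ℕ} (hp : 3 ≤ p) (hpn : p + 2 ≤ n) : AttainsBound (B₃ n p) := by
  classical
  refine attainsBound_of_upperSet_three (fun v => ?_) fun s t ht hst hne => Or.inl ?_
  · rw [B₃_degree hp hpn]; split_ifs <;> omega
  · have h1 : #(upperSet (B₃ n p) t) ≤ 1 := by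
      refine card_le_one.2 fun a ha b hb => ?_
      rw [mem_upperSet, B₃_degree hp hpn] at ha hb
      refine Fin.ext ?_
      split_ifs at ha hb <;> omega
    have := card_le_card (upperSet_subset (G := B₃ n p) hst)
    have := card_pos.2 hne
    omega

theorem B₅_inGamma [NeZero n] (hπ : ∀ i, π i = if i = 0 ∨ i = 1 then 3 else 2) {p : ℕ} (hp : 3 ≤ p)
    (hpn : p + 1 ≤ n) : InGamma π (B₅ n p) := by
  have hv1 : (1 : Fin n).val = 1 := Nat.mod_eq_of_lt (show 1 < n by omega)
  have hv0 : (0 : Fin n).val = 0 := rfl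
  -- The second vertex of degree 3 is `p - 1`, whereas `π` lists it at index `1`.
  refine ⟨B₅_connected p, Equiv.swap 1 ⟨p - 1, by omega⟩, fun i => ?_⟩
  rw [B₅_degree hp hpn, hπ, Equiv.swap_apply_def]
  simp only [Fin.ext_iff, hv1, hv0]
  grind

theorem B₅_attainsBound {p : ℕ} (hp : 3 ≤ p) (hpn : p + 1 ≤ n) : AttainsBound (B₅ n p) := by
  classical
  refine attainsBound_of_upperSet_three (fun v => ?_) fun s t ht hst hne => Or.inr ?_
  · rw [B₅_degree hp hpn]; split_ifs <;> omega
  · have hs : s ≤ 3 := by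
      obtain ⟨v, hv⟩ := hne
      rw [mem_upperSet, B₅_degree hp hpn] at hv
      split_ifs at hv <;> omega
    obtain rfl : t = 3 := by omega
    obtain rfl : s = 3 := by omega
    have hne : (⟨0, by omega⟩ : Fin n) ≠ ⟨p - 1, by omega⟩ := by
      simp only [ne_eq, Fin.ext_iff]; omega
    have hS : upperSet (B₅ n p) 3 = {⟨0, by omega⟩, ⟨p - 1, by omega⟩} := by
      ext v
      rw [mem_upperSet, B₅_degree hp hpn]
      simp only [mem_insert, mem_singleton, Fin.ext_iff]
      split_ifs <;> omega
    have hadj : (B₅ n p).Adj ⟨0, by omega⟩ ⟨p - 1, by omega⟩ := by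
      simp only [B₅, SimpleGraph.fromRel_adj, ne_eq, Fin.ext_iff]
      first | omega | grind
    rw [hS, card_pair hne, adjCount, sum_pair hne, sum_pair hne, sum_pair hne]
    simp [hadj, hadj.symm, maxEdges]

end Bicyclic

/-! ### Two triangles with paths attached to their common vertex -/

namespace Bicyclic

open Finset

variable {n : ℕ} {π : Fin n → ℕ}

section attachPaths

variable {W : Type*} (H : SimpleGraph W) (w : W) {k : ℕ} (l : Fin k → ℕ)

theorem attachPaths_adj_inl_inl (x y : W) :
    (attachPaths H w l).Adj (.inl x) (.inl y) ↔ H.Adj x y := by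
  simp only [attachPaths, SimpleGraph.fromRel_adj, ne_eq, Sum.inl.injEq]
  exact ⟨fun h => h.2.elim id fun h => h.symm, fun h => ⟨h.ne, Or.inl h⟩⟩

theorem attachPaths_adj_inl_inr (x : W) (i : Fin k) (s : Fin (l i)) :
    (attachPaths H w l).Adj (.inl x) (.inr ⟨i, s⟩) ↔ x = w ∧ s.val = 0 := by
  simp [attachPaths, SimpleGraph.fromRel_adj]

theorem attachPaths_adj_inr_inl (x : W) (i : Fin k) (s : Fin (l i)) :
    (attachPaths H w l).Adj (.inr ⟨i, s⟩) (.inl x) ↔ x = w ∧ s.val = 0 := by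
  rw [SimpleGraph.adj_comm, attachPaths_adj_inl_inr]

theorem attachPaths_adj_inr_inr (i j : Fin k) (s : Fin (l i)) (t : Fin (l j)) :
    (attachPaths H w l).Adj (.inr ⟨i, s⟩) (.inr ⟨j, t⟩) ↔
      i = j ∧ (s.val + 1 = t.val ∨ t.val + 1 = s.val) := by
  simp only [attachPaths, SimpleGraph.fromRel_adj, ne_eq, Sum.inr.injEq]
  constructor
  · rintro ⟨-, ⟨h1, h2⟩ | ⟨h1, h2⟩⟩
    · exact ⟨h1, Or.inl h2⟩
    · exact ⟨h1.symm, Or.inr h2⟩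
  · rintro ⟨rfl, h⟩
    refine ⟨fun e => ?_, by tauto⟩
    have : s = t := by simpa using e
    subst this
    omega

theorem attachPaths_connected (hH : H.Connected) : (attachPaths H w l).Connected := by
  have hinl : ∀ x, (attachPaths H w l).Reachable (.inl w) (.inl x) := fun x =>
    (hH.preconnected w x).map
      ⟨Sum.inl, fun {a b} h => (attachPaths_adj_inl_inl H w l a b).2 h⟩
  have hinr : ∀ i s, ∀ hs : s < l i,
      (attachPaths H w l).Reachable (.inl w) (.inr ⟨i, ⟨s, hs⟩⟩) := by
    intro i s
    induction s with
    | zero =>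
      intro hs
      exact SimpleGraph.Adj.reachable ((attachPaths_adj_inl_inr H w l _ _ _).2 ⟨rfl, rfl⟩)
    | succ s ih =>
      intro hs
      exact (ih (by omega)).trans (SimpleGraph.Adj.reachable
        ((attachPaths_adj_inr_inr H w l _ _ _ _).2 ⟨rfl, Or.inl rfl⟩))
  refine (SimpleGraph.connected_iff_exists_forall_reachable _).2 ⟨.inl w, ?_⟩
  rintro (x | ⟨i, s⟩)
  · exact hinl x
  · exact hinr i s.val s.2

open Classical in
theorem attachPaths_degree_inr [Fintype W] (i : Fin k) (s : Fin (l i)) :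
    (attachPaths H w l).degree (.inr ⟨i, s⟩) = if s.val + 1 = l i then 1 else 2 := by
  -- `p` is the neighbour on the side of `w`, namely `w` itself or the preceding path vertex; the
  -- degree then depends only on whether the path continues.
  obtain ⟨p, hp, hadj⟩ : ∃ p : W ⊕ (i : Fin k) × Fin (l i),
      (∀ t : Fin (l i), p = .inr ⟨i, t⟩ → t.val + 1 = s.val) ∧
      ∀ y, (attachPaths H w l).Adj (.inr ⟨i, s⟩) y ↔
        y = p ∨ ∃ h : s.val + 1 < l i, y = .inr ⟨i, ⟨s.val + 1, h⟩⟩ := by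
    by_cases hs : s.val = 0
    · refine ⟨.inl w, by simp, ?_⟩
      rintro (x | ⟨j, t⟩)
      · rw [attachPaths_adj_inr_inl]; simp [hs]
      · rw [attachPaths_adj_inr_inr]
        constructor
        · rintro ⟨rfl, h⟩
          refine Or.inr ⟨by have := t.2; omega, ?_⟩
          congr 2
          exact Fin.ext (by simp only; omega)
        · rintro (h | ⟨h1, h2⟩)
          · simp at h
          · simp only [Sum.inr.injEq, Sigma.mk.injEq] at h2
            obtain ⟨rfl, h2⟩ := h2
            rw [eq_of_heq h2]
            exact ⟨rfl, Or.inl rfl⟩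
    · refine ⟨.inr ⟨i, ⟨s.val - 1, by omega⟩⟩, fun t ht => ?_, ?_⟩
      · simp only [Sum.inr.injEq, Sigma.mk.injEq, true_and] at ht
        rw [← eq_of_heq ht]
        simp only
        omega
      rintro (x | ⟨j, t⟩)
      · rw [attachPaths_adj_inr_inl]; simp [hs]
      · rw [attachPaths_adj_inr_inr]
        constructor
        · rintro ⟨rfl, h | h⟩
          · refine Or.inr ⟨by have := t.2; omega, ?_⟩
            congr 2
            exact Fin.ext h.symm
          · refine Or.inl ?_
            congr 2
            exact Fin.ext (by simp only; omega)
        · rintro (h2 | ⟨h1, h2⟩)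
          all_goals
            simp only [Sum.inr.injEq, Sigma.mk.injEq] at h2
            obtain ⟨rfl, h2⟩ := h2
            rw [eq_of_heq h2]
            refine ⟨rfl, ?_⟩
            first
              | exact Or.inl rfl
              | simp only; omega
  split_ifs with hs
  · rw [degree_eq_card _ _ {p}, card_singleton]
    intro y
    rw [hadj, mem_singleton]
    exact ⟨fun h => h.elim id fun ⟨h, _⟩ => absurd hs h.ne, Or.inl⟩
  · have hs' : s.val + 1 < l i := by have := s.2; omega
    rw [degree_eq_card _ _ {p, .inr ⟨i, ⟨s.val + 1, hs'⟩⟩}, card_pair]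
    · intro e
      have := hp _ e
      simp only at this
      omega
    · intro y
      rw [hadj, mem_insert, mem_singleton]
      simp [hs']

end attachPaths

theorem B₂_adj (x y : Fin 5) : B₂.Adj x y ↔
    x ≠ y ∧ (x = 0 ∨ y = 0 ∨ (x = 1 ∧ y = 2) ∨ (x = 2 ∧ y = 1) ∨ (x = 3 ∧ y = 4) ∨
      (x = 4 ∧ y = 3)) := by
  fin_cases x <;> fin_cases y <;> simp [B₂]

theorem B₂_connected : B₂.Connected :=
  connected_of_exists_adj_lt _ fun j hj =>
    have hj0 : 0 < j := by rw [Fin.lt_def]; exact Nat.pos_of_ne_zero hj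
    ⟨0, hj0, (B₂_adj _ _).2 ⟨hj0.ne, Or.inl rfl⟩⟩

variable {k : ℕ} {l : Fin k → ℕ}

open Classical in
theorem attachPaths_B₂_degree_zero (hl : ∀ i, 1 ≤ l i) :
    (attachPaths B₂ 0 l).degree (.inl 0) = k + 4 := by
  rw [degree_eq_card _ _ (disjSum {1, 2, 3, 4}
    (univ.image fun i : Fin k => (⟨i, ⟨0, hl i⟩⟩ : (i : Fin k) × Fin (l i))))]
  · rw [card_disjSum, card_image_of_injective _ fun i j h => congrArg Sigma.fst h, card_univ,
      Fintype.card_fin, add_comm]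
    rfl
  · rintro (x | ⟨i, s⟩)
    · rw [attachPaths_adj_inl_inl, inl_mem_disjSum, B₂_adj]
      fin_cases x <;> simp
    · rw [attachPaths_adj_inl_inr, inr_mem_disjSum, mem_image]
      simp only [true_and, mem_univ, Sigma.mk.injEq]
      constructor
      · intro h
        exact ⟨i, rfl, heq_of_eq (Fin.ext h.symm)⟩
      · rintro ⟨j, rfl, h⟩
        rw [← eq_of_heq h]

open Classical in
theorem attachPaths_B₂_degree_inl {x : Fin 5} (hx : x ≠ 0) :
    (attachPaths B₂ 0 l).degree (.inl x) = 2 := by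
  obtain ⟨z, hz, hadj⟩ : ∃ z : Fin 5, z ≠ 0 ∧ ∀ y, B₂.Adj x y ↔ y = 0 ∨ y = z := by
    have : ∃ z : Fin 5, z ≠ 0 ∧ ∀ y, (x ≠ y ∧ (x = 0 ∨ y = 0 ∨ (x = 1 ∧ y = 2) ∨
      (x = 2 ∧ y = 1) ∨ (x = 3 ∧ y = 4) ∨ (x = 4 ∧ y = 3))) ↔ y = 0 ∨ y = z := by
      revert x; decide
    simpa only [B₂_adj] using this
  rw [degree_eq_card _ _ {.inl 0, .inl z}, card_pair (by simpa using hz.symm)]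
  rintro (y | ⟨i, s⟩)
  · rw [attachPaths_adj_inl_inl, hadj]; simp
  · rw [attachPaths_adj_inl_inr]; simp [hx]

open Classical in
theorem attachPaths_B₂_degree_le (y : Fin 5 ⊕ (i : Fin k) × Fin (l i)) (hy : y ≠ .inl 0) :
    (attachPaths B₂ 0 l).degree y = 1 ∨ (attachPaths B₂ 0 l).degree y = 2 := by
  rcases y with x | ⟨i, s⟩
  · exact Or.inr (attachPaths_B₂_degree_inl fun e => hy (e ▸ rfl))
  · rw [attachPaths_degree_inr]; split_ifs <;> simp

open Classical in
theorem card_attachPaths_B₂_leaves (hl : ∀ i, 1 ≤ l i) :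
    #(univ.filter fun y => (attachPaths B₂ 0 l).degree y = 1) = k := by
  have : (univ.filter fun y => (attachPaths B₂ 0 l).degree y = 1) =
      (univ : Finset (Fin k)).image fun i =>
        (.inr ⟨i, ⟨l i - 1, Nat.sub_lt (hl i) one_pos⟩⟩ : Fin 5 ⊕ (i : Fin k) × Fin (l i)) := by
    ext y
    simp only [mem_filter, mem_univ, true_and, mem_image]
    rcases y with x | ⟨i, s⟩
    · by_cases hx : x = 0
      · subst hx
        rw [attachPaths_B₂_degree_zero hl]; simp
      · rw [attachPaths_B₂_degree_inl hx]; simp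
    · rw [attachPaths_degree_inr]
      constructor
      · intro h
        refine ⟨i, ?_⟩
        congr 2
        refine Fin.ext ?_
        simp only
        split_ifs at h <;> omega
      · rintro ⟨j, h⟩
        simp only [Sum.inr.injEq, Sigma.mk.injEq] at h
        obtain ⟨rfl, h⟩ := h
        rw [← eq_of_heq h]
        have := hl j
        exact if_pos (by simp only; omega)
  rw [this, card_image_of_injective _ fun i j h => congrArg Sigma.fst (Sum.inr.inj h), card_univ, Fintype.card_fin]

/-! ### Degree sequences with one large entry and all others 1 or 2. -/

theorem exists_equiv_of_card_filter_eq {α β : Type*} [Fintype α] [Fintype β] {g : α → ℕ}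
    {h : β → ℕ} (hgh : ∀ c, #(univ.filter fun a => g a = c) = #(univ.filter fun b => h b = c)) :
    ∃ e : α ≃ β, ∀ a, h (e a) = g a := by
  have e : ∀ c, Nonempty ({a // g a = c} ≃ {b // h b = c}) := fun c =>
    Fintype.card_eq.1 (by rw [Fintype.card_subtype, Fintype.card_subtype, hgh])
  exact ⟨Equiv.ofFiberEquiv fun c => (e c).some, fun a => Equiv.ofFiberEquiv_map _ a⟩

theorem filter_eq_singleton_of_one_two {α : Type*} [Fintype α] {g : α → ℕ} {D : ℕ} (hD : 3 ≤ D)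
    {a : α} (ha : g a = D) (hg : ∀ x, x ≠ a → g x = 1 ∨ g x = 2) :
    (univ.filter fun y => g y = D) = {a} := by
  ext y
  simp only [mem_filter, mem_univ, true_and, mem_singleton]
  refine ⟨fun hy => ?_, fun hy => hy ▸ ha⟩
  by_contra hne
  have := hg y hne
  omega

theorem card_eq_of_one_two {α : Type*} [Fintype α] {g : α → ℕ} {D : ℕ} (hD : 3 ≤ D)
    {a : α} (ha : g a = D) (hg : ∀ x, x ≠ a → g x = 1 ∨ g x = 2) :
    Fintype.card α = #(univ.filter fun y => g y = 1) + #(univ.filter fun y => g y = 2) + 1 := by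
  classical
  have h := card_eq_sum_card_fiberwise (s := univ) (t := {1, 2, D}) (f := g) fun y _ => by
    by_cases hy : y = a
    · subst hy; simp [ha]
    · rcases hg y hy with e | e <;> simp [e]
  rw [sum_insert (by simp; omega), sum_pair (by omega), filter_eq_singleton_of_one_two hD ha hg,
    card_singleton, card_univ] at h
  omega

/-- The value `D` is taken once, so the total and the number of ones determine the number of twos.
-/
theorem card_filter_eq_of_one_two {α β : Type*} [Fintype α] [Fintype β] {g : α → ℕ}
    {h : β → ℕ} (hcard : Fintype.card α = Fintype.card β) {D : ℕ} (hD : 3 ≤ D) {a : α} {b : β}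
    (ha : g a = D) (hb : h b = D) (hg : ∀ x, x ≠ a → g x = 1 ∨ g x = 2)
    (hh : ∀ x, x ≠ b → h x = 1 ∨ h x = 2)
    (h1 : #(univ.filter fun a => g a = 1) = #(univ.filter fun b => h b = 1)) (c : ℕ) :
    #(univ.filter fun a => g a = c) = #(univ.filter fun b => h b = c) := by
  rw [card_eq_of_one_two hD ha hg, card_eq_of_one_two hD hb hh] at hcard
  by_cases c1 : c = 1
  · rw [c1, h1]
  by_cases c2 : c = 2
  · rw [c2]; omega
  by_cases cD : c = D
  · rw [cD, filter_eq_singleton_of_one_two hD ha hg, filter_eq_singleton_of_one_two hD hb hh,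
      card_singleton, card_singleton]
  · rw [filter_eq_empty_iff.2 fun x _ hx => ?_, filter_eq_empty_iff.2 fun x _ hx => ?_, card_empty,
      card_empty]
    · by_cases hxb : x = b
      · subst hxb; omega
      · have := hh x hxb; omega
    · by_cases hxa : x = a
      · subst hxa; omega
      · have := hg x hxa; omega

theorem IsBicyclicDegreeSequence.one_or_two [NeZero n] (hπ : IsBicyclicDegreeSequence π)
    (h1 : π 1 = 2) (i : Fin n) (hi : i ≠ 0) : π i = 1 ∨ π i = 2 := by
  have hn := hπ.four_le
  have hv1 : (1 : Fin n).val = 1 := Nat.mod_eq_of_lt (show 1 < n by omega)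
  have := hπ.pos i
  have : π i ≤ π 1 := hπ.1 (by
    rw [Fin.le_def, hv1]
    have : i.val ≠ 0 := fun e => hi (Fin.ext e)
    omega)
  omega

theorem IsBicyclicDegreeSequence.card_leaves [NeZero n] (hπ : IsBicyclicDegreeSequence π)
    (h0 : 5 ≤ π 0) (h1 : π 1 = 2) : #(univ.filter fun i => π i = 1) + 4 = π 0 := by
  have hsum := hπ.sum_eq
  -- Raising every entry 1 to 2 makes all entries after the first equal to 2; comparing with the
  -- total 2(n + 1) counts the ones.
  have h : ∑ i, (π i + if π i = 1 then 1 else 0) = ∑ i : Fin n, (2 + if i = 0 then π 0 - 2 else 0) := by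
    refine sum_congr rfl fun i _ => ?_
    by_cases hi : i = 0
    · subst hi
      rw [if_pos rfl, if_neg (by omega)]; omega
    · rw [if_neg hi]
      rcases hπ.one_or_two h1 i hi with e | e <;> simp [e]
  rw [sum_add_distrib, sum_add_distrib, ← card_filter, hsum, sum_const, card_univ, Fintype.card_fin,
    sum_ite_eq' univ (0 : Fin n), if_pos (mem_univ _), smul_eq_mul] at h
  omega

open Classical in
theorem attachPaths_B₂_inGamma [NeZero n] (hπ : IsBicyclicDegreeSequence π) (h0 : 5 ≤ π 0)
    (h1 : π 1 = 2) {l : Fin (π 0 - 4) → ℕ} (hl : ∀ i, 1 ≤ l i)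
    (hcard : Fintype.card (Fin 5 ⊕ (i : Fin (π 0 - 4)) × Fin (l i)) = n) :
    InGamma π (attachPaths B₂ 0 l) := by
  refine ⟨attachPaths_connected _ _ _ B₂_connected, ?_⟩
  have hleaf := hπ.card_leaves h0 h1
  exact exists_equiv_of_card_filter_eq (card_filter_eq_of_one_two
    (by rw [hcard, Fintype.card_fin]) (D := π 0) (by omega) (a := (0 : Fin n))
    (b := (.inl 0 : Fin 5 ⊕ (i : Fin (π 0 - 4)) × Fin (l i))) rfl
    (by rw [attachPaths_B₂_degree_zero hl]; omega) (hπ.one_or_two h1) attachPaths_B₂_degree_le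
    (by rw [card_attachPaths_B₂_leaves hl]; omega))

theorem maxEdges_le (p : ℕ) : maxEdges p ≤ p + 1 := by
  rcases p with _ | _ | _ | _ | p <;> simp [maxEdges]

-- For thresholds at least 3 only the centre remains in the upper set. Almost equal lengths enter
-- here: either every path has two or more vertices and all neighbours of the centre have degree at
-- least 2, or every path has at most two vertices and all vertices of degree 2 are adjacent to the
-- centre.
open Classical in
theorem attachPaths_B₂_attainsBound (hl : ∀ i, 1 ≤ l i) (hll : ∀ i j, l i ≤ l j + 1)
    (hE : 2 * (Fintype.card (Fin 5 ⊕ (i : Fin k) × Fin (l i)) + 1) ≤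
      adjCount (attachPaths B₂ 0 l) univ univ) :
    AttainsBound (attachPaths B₂ 0 l) := by
  intro s t hst
  have hsub := upperSet_subset (G := attachPaths B₂ 0 l) hst
  by_cases ht1 : t ≤ 1
  · left
    have : upperSet (attachPaths B₂ 0 l) t = univ := by
      ext y
      simp only [mem_upperSet, mem_univ, iff_true]
      by_cases hy : y = .inl 0
      · rw [hy, attachPaths_B₂_degree_zero hl]; omega
      · have := attachPaths_B₂_degree_le y hy
        omega
    rw [this, adjCount_univ_right]
  by_cases hs2 : s ≤ 2
  · obtain rfl : s = 2 := by omega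
    obtain rfl : t = 2 := by omega
    -- At least n + 1 edges in total leave at least a + 1 edges among the a vertices of degree at
    -- least 2.
    have h1 := adjCount_univ_le_upperSet_two (attachPaths B₂ 0 l)
    have h2 := maxEdges_le #(upperSet (attachPaths B₂ 0 l) 2)
    right; right
    omega
  have hsingle : upperSet (attachPaths B₂ 0 l) s ⊆ {.inl 0} := by
    intro y hy
    rw [mem_upperSet] at hy
    rw [mem_singleton]
    by_contra hne
    have := attachPaths_B₂_degree_le y hne
    omega
  rcases subset_singleton_iff.1 hsingle with he | he
  · left; simp [he, adjCount]
  by_cases hl2 : (∀ i, 2 ≤ l i) ∧ t = 2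
  · left
    rw [← adjCount_univ_right, he]
    refine sum_congr rfl fun u hu => sum_subset (subset_univ _) fun y _ hy => if_neg fun hadj => hy ?_
    rw [mem_singleton] at hu
    subst hu
    rw [mem_upperSet, hl2.2]
    rcases y with x | ⟨i, j⟩
    · rw [attachPaths_adj_inl_inl] at hadj
      rw [attachPaths_B₂_degree_inl hadj.ne']
    · rw [attachPaths_adj_inl_inr] at hadj
      rw [attachPaths_degree_inr, if_neg (by have := hl2.1 i; omega)]
  · right; left
    rw [he]
    refine ⟨card_singleton _, ?_⟩
    rw [adjCount, sum_singleton, ← card_filter]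
    have : upperSet (attachPaths B₂ 0 l) t ⊆ insert (.inl 0) ((upperSet (attachPaths B₂ 0 l) t).filter fun y => (attachPaths B₂ 0 l).Adj (.inl 0) y) := by
      intro y hy
      rw [mem_insert, mem_filter]
      by_cases hy0 : y = .inl 0
      · exact Or.inl hy0
      refine Or.inr ⟨hy, ?_⟩
      rw [mem_upperSet] at hy
      have hdeg := attachPaths_B₂_degree_le y hy0
      have ht2 : t = 2 := by omega
      simp only [ht2, and_true, not_forall, not_le] at hl2
      obtain ⟨i0, hi0⟩ := hl2
      rcases y with x | ⟨i, j⟩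
      · rw [attachPaths_adj_inl_inl, B₂_adj]
        exact ⟨fun e => hy0 (e ▸ rfl), Or.inl rfl⟩
      · rw [attachPaths_adj_inl_inr]
        refine ⟨rfl, ?_⟩
        rw [attachPaths_degree_inr] at hy
        have h3 := hll i i0
        have h4 := j.2
        split_ifs at hy <;> omega
    exact (card_le_card this).trans (card_insert_le _ _)

theorem IsBM₂.attainsBound [NeZero n] (hπ : IsBicyclicDegreeSequence π) (h0 : 5 ≤ π 0)
    (h1 : π 1 = 2) {V : Type*} [Fintype V] {B : SimpleGraph V} (h : IsBM₂ n (π 0) B) :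
    InGamma π B ∧ AttainsBound B := by
  obtain ⟨hcard, l, hl, hll, ⟨e⟩⟩ := h
  have hg := attachPaths_B₂_inGamma hπ h0 h1 hl (by rw [← Fintype.card_congr e.toEquiv, hcard])
  refine ⟨hg.of_iso e.symm, AttainsBound.of_iso e.symm (attachPaths_B₂_attainsBound hl hll ?_)⟩
  rw [hg.2.adjCount_univ, hπ.sum_eq, hg.2.card_eq]

end Bicyclic

/-! ### The graph of a monotone parent map -/

namespace Bicyclic

open Finset

variable {n : ℕ} {π : Fin n → ℕ}

/-- The graph consisting of two triangles on the first four vertices, in which each later vertex `j`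
is joined to the preceding vertex `par j`. -/
def parentGraph (n : ℕ) (par : ℕ → ℕ) : SimpleGraph (Fin n) :=
  SimpleGraph.fromRel fun i j =>
    i < j ∧ ((4 ≤ j.val ∧ i.val = par j.val) ∨ (j.val < 4 ∧ i.val < 2))

/-- The heights of the vertices of `parentGraph n par`. -/
def height (par : ℕ → ℕ) : ℕ → ℕ
  | 0 => 0
  -- The `min` secures termination for arbitrary `par` and has no effect when `par (j + 1)` is
  -- smaller than `j + 1`.
  | j + 1 => if j < 3 then 1 else height par (min (par (j + 1)) j) + 1
termination_by j => j
decreasing_by omega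

/-- `par` sends each of `4, …, n - 1` to a smaller number, in a non-decreasing way. -/
structure IsMonotoneParent (n : ℕ) (par : ℕ → ℕ) : Prop where
  lt : ∀ j, 4 ≤ j → j < n → par j < j
  mono : ∀ i j, 4 ≤ i → i ≤ j → j < n → par i ≤ par j

variable {par : ℕ → ℕ}

theorem parentGraph_adj_of_lt {i j : Fin n} (hij : i < j) :
    (parentGraph n par).Adj i j ↔
      (4 ≤ j.val ∧ i.val = par j.val) ∨ (j.val < 4 ∧ i.val < 2) := by
  simp only [parentGraph, SimpleGraph.fromRel_adj, hij, hij.not_gt, hij.ne, ne_eq, not_false_eq_true,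
    true_and, false_and, or_false]

theorem height_of_four_le {j : ℕ} (hj : 4 ≤ j) (hlt : par j < j) :
    height par j = height par (par j) + 1 := by
  obtain ⟨k, rfl⟩ : ∃ k, j = k + 1 := ⟨j - 1, by omega⟩
  rw [height, if_neg (by omega), min_eq_left (by omega)]

theorem height_of_lt_four {j : ℕ} (hj : j < 4) : height par j = if j = 0 then 0 else 1 := by
  rcases j with _ | j
  · rw [height]; rfl
  · rw [height, if_pos (by omega), if_neg (by omega)]

theorem height_pos {j : ℕ} (hj : j ≠ 0) : 1 ≤ height par j := by
  obtain ⟨k, rfl⟩ : ∃ k, j = k + 1 := ⟨j - 1, by omega⟩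
  rw [height]
  split_ifs <;> omega

theorem height_le_one {j : ℕ} (hj : j < 4) : height par j ≤ 1 := by
  rw [height_of_lt_four hj]; split_ifs <;> omega

theorem IsMonotoneParent.height_mono (h : IsMonotoneParent n par) {i j : ℕ} (hij : i ≤ j)
    (hj : j < n) : height par i ≤ height par j := by
  induction j using Nat.strong_induction_on generalizing i with
  | _ j ih =>
    by_cases hi0 : i = 0
    · subst hi0; rw [height]; exact Nat.zero_le _
    by_cases hi4 : i < 4
    · exact (height_le_one hi4).trans (height_pos (by omega))
    · have hlt := h.lt j (by omega) hj
      rw [height_of_four_le (by omega) (h.lt i (by omega) (by omega)),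
        height_of_four_le (by omega) hlt]
      exact Nat.succ_le_succ (ih _ hlt (h.mono i j (by omega) hij hj) (by omega))

theorem IsMonotoneParent.connected [NeZero n] (h : IsMonotoneParent n par) :
    (parentGraph n par).Connected := by
  refine connected_of_exists_adj_lt _ fun j hj => ?_
  by_cases hj4 : j.val < 4
  · have h0 : (⟨0, by omega⟩ : Fin n) < j := by rw [Fin.lt_def]; simp only; omega
    exact ⟨_, h0, (parentGraph_adj_of_lt h0).2 (Or.inr ⟨hj4, by simp⟩)⟩
  · have hlt := h.lt j (by omega) j.2
    have h0 : (⟨par j, by omega⟩ : Fin n) < j := hlt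
    exact ⟨_, h0, (parentGraph_adj_of_lt h0).2 (Or.inl ⟨by omega, rfl⟩)⟩

theorem IsMonotoneParent.height_adj_lt (h : IsMonotoneParent n par) {i j : Fin n} (hij : i < j)
    (hadj : (parentGraph n par).Adj i j) :
    height par j ≤ height par i + 1 ∧ height par i ≤ height par j := by
  refine ⟨?_, h.height_mono hij.le j.2⟩
  rcases (parentGraph_adj_of_lt hij).1 hadj with ⟨h1, h2⟩ | ⟨h1, h2⟩
  · rw [height_of_four_le h1 (h.lt j h1 j.2), h2]
  · exact (height_le_one h1).trans (by omega)

/-- Following parents gives a walk of that length, and no walk is shorter because the height changes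
by at most one along an edge. -/
theorem IsMonotoneParent.dist_eq_height [NeZero n] (h : IsMonotoneParent n par) (j : Fin n) :
    (parentGraph n par).dist 0 j = height par j := by
  refine le_antisymm ?_ ?_
  · have key : ∀ k, ∀ j : Fin n, j.val = k → (parentGraph n par).dist 0 j ≤ height par j := by
      intro k
      induction k using Nat.strong_induction_on with
      | _ k ih =>
        intro j hj
        by_cases hj0 : j.val = 0
        · rw [show j = 0 from Fin.ext hj0, SimpleGraph.dist_self]; exact Nat.zero_le _
        by_cases hj4 : j.val < 4
        · have h0 : (0 : Fin n) < j := by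
            rw [Fin.lt_def, Fin.val_zero]; exact Nat.pos_of_ne_zero hj0
          rw [SimpleGraph.dist_eq_one_iff_adj.2
            ((parentGraph_adj_of_lt h0).2 (Or.inr ⟨hj4, by simp⟩))]
          exact height_pos hj0
        · have hlt := h.lt j (by omega) j.2
          have h0 : (⟨par j, by omega⟩ : Fin n) < j := hlt
          have hadj := (parentGraph_adj_of_lt h0).2 (Or.inl ⟨by omega, rfl⟩)
          have h1 := h.connected.dist_triangle (u := 0) (v := ⟨par j, by omega⟩) (w := j)
          rw [SimpleGraph.dist_eq_one_iff_adj.2 hadj] at h1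
          rw [height_of_four_le (by omega) hlt]
          exact h1.trans (Nat.succ_le_succ (ih _ (by omega) _ rfl))
    exact key _ j rfl
  · obtain ⟨p, hp⟩ := h.connected.exists_walk_length_eq_dist 0 j
    rw [← hp]
    have key : ∀ {a b : Fin n} (p : (parentGraph n par).Walk a b),
        height par b ≤ height par a + p.length := by
      intro a b p
      induction p with
      | nil => simp
      | @cons a c b hac p ih =>
        rw [SimpleGraph.Walk.length_cons]
        rcases lt_or_gt_of_ne hac.ne with hlt | hlt
        · have := h.height_adj_lt hlt hac
          omega
        · have := h.height_adj_lt hlt hac.symm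
          omega
    have := key p
    have h0 : height par 0 = 0 := by rw [height]
    rw [Fin.val_zero, h0] at this
    omega

open Classical in
theorem IsMonotoneParent.isBFSOrdering [NeZero n] (h : IsMonotoneParent n par)
    (hdeg : ∀ i j, i ≤ j → (parentGraph n par).degree j ≤ (parentGraph n par).degree i) :
    IsBFSOrdering (parentGraph n par) (Equiv.refl _) := by
  refine ⟨h.connected, hdeg, fun i j hij => ?_, fun u w x z hux _ hwz _ huw hx hz hlt => ?_⟩
  · simp only [Equiv.refl_apply, h.dist_eq_height]
    exact h.height_mono hij j.2
  · simp only [Equiv.refl_apply, h.dist_eq_height] at *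
    -- `w` is not the root, so `x` and `z` have height at least 2. They lie outside the two
    -- triangles, with parents `u` and `w`, and monotonicity of `par` orders them.
    have hw0 : 1 ≤ height par w := height_pos (by rw [Fin.lt_def] at hlt; omega)
    have key : ∀ a b : Fin n, (parentGraph n par).Adj a b → height par b = height par a + 1 →
        1 ≤ height par a → 4 ≤ b.val ∧ a.val = par b.val := by
      intro a b hab hh ha
      have hab' : a < b := by
        by_contra! hle
        have := h.height_mono hle a.2
        omega
      rcases (parentGraph_adj_of_lt hab').1 hab with h1 | ⟨h1, -⟩
      · exact h1
      · have := height_le_one (par := par) h1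
        omega
    obtain ⟨hx4, hxp⟩ := key u x hux hx (by omega)
    obtain ⟨hz4, hzp⟩ := key w z hwz (by omega) hw0
    by_contra! hle
    have := h.mono z x hz4 hle x.2
    rw [Fin.lt_def] at hlt
    omega

theorem parentGraph_adj_of_lt_four {i j : Fin n} (hi : i.val < 4) (hj : j.val < 4) :
    (parentGraph n par).Adj i j ↔ i.val ≠ j.val ∧ (i.val < 2 ∨ j.val < 2) := by
  rcases lt_trichotomy i j with hlt | rfl | hlt
  · rw [parentGraph_adj_of_lt hlt]
    rw [Fin.lt_def] at hlt
    omega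
  · simp
  · rw [SimpleGraph.adj_comm, parentGraph_adj_of_lt hlt]
    rw [Fin.lt_def] at hlt
    omega

/-- Each round removes at least the last surviving vertex outside the first four, whose only
surviving neighbour is its parent. Each of the first four vertices keeps two neighbours among them.
-/
theorem baseSet_parentGraph (hn : 4 ≤ n) : baseSet (parentGraph n par) = {x | x.val < 4} := by
  ext x
  rw [baseSet, Set.mem_iInter, Set.mem_ofPred_eq]
  constructor
  · intro hx
    have key : ∀ k, ∀ x : Fin n, x ∈ (prune (parentGraph n par))^[k] Set.univ →
        x.val < 4 ∨ x.val + k < n := by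
      intro k
      induction k with
      | zero => intro x _; exact Or.inr x.2
      | succ k ih =>
        intro x hx
        rw [Function.iterate_succ_apply'] at hx
        obtain ⟨hx1, hx2⟩ := hx
        by_contra! hcon
        have hpar : ∀ a : Fin n, (parentGraph n par).Adj x a →
            a ∈ (prune (parentGraph n par))^[k] Set.univ → a.val = par x.val := by
          intro a hxa ha
          rcases lt_or_gt_of_ne hxa.ne with hlt | hlt
          · have := ih a ha
            rw [Fin.lt_def] at hlt
            omega
          · rcases (parentGraph_adj_of_lt hlt).1 hxa.symm with h1 | h1
            · exact h1.2
            · omega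
        obtain ⟨a, b, ⟨ha1, ha2⟩, ⟨hb1, hb2⟩, hab⟩ := (Set.one_lt_ncard_iff (Set.toFinite _)).1 hx2
        exact hab (Fin.ext ((hpar a ha1 ha2).trans (hpar b hb1 hb2).symm))
    rcases key n x (hx n) with h | h <;> omega
  · intro hx k
    have key : ∀ k, ∀ x : Fin n, x.val < 4 → x ∈ (prune (parentGraph n par))^[k] Set.univ := by
      intro k
      induction k with
      | zero => intro x _; trivial
      | succ k ih =>
        intro x hx
        rw [Function.iterate_succ_apply']
        refine ⟨ih x hx, (Set.one_lt_ncard_iff (Set.toFinite _)).2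
          ⟨⟨if x.val = 0 then 1 else 0, by split_ifs <;> omega⟩,
            ⟨if x.val ≤ 1 then 2 else 1, by split_ifs <;> omega⟩, ⟨?_, ih _ ?_⟩, ⟨?_, ih _ ?_⟩, ?_⟩⟩
        · rw [SimpleGraph.mem_neighborSet, parentGraph_adj_of_lt_four hx]
          all_goals simp only; split_ifs <;> omega
        · simp only; split_ifs <;> omega
        · rw [SimpleGraph.mem_neighborSet, parentGraph_adj_of_lt_four hx]
          all_goals simp only; split_ifs <;> omega
        · simp only; split_ifs <;> omega
        · rw [ne_eq, Fin.ext_iff]; simp only; split_ifs <;> first | omega | simp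
    exact key k x hx

theorem B₁_adj (x y : Fin 4) : B₁.Adj x y ↔ x.val ≠ y.val ∧ (x.val < 2 ∨ y.val < 2) := by
  fin_cases x <;> fin_cases y <;> simp [B₁]

/-- The base graph of `parentGraph n par`. -/
def baseGraphIso (hn : 4 ≤ n) : B₁ ≃g baseGraph (parentGraph n par) where
  toFun i := ⟨⟨i.val, by omega⟩, by rw [baseSet_parentGraph hn]; exact i.2⟩
  invFun x := ⟨x.1.val, by
    have h : ∀ y, y ∈ baseSet (parentGraph n par) → y.val < 4 := fun y hy => by
      rwa [baseSet_parentGraph hn] at hy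
    exact h _ x.2⟩
  left_inv _ := rfl
  right_inv _ := rfl
  map_rel_iff' {i j} := by
    rw [B₁_adj]
    exact parentGraph_adj_of_lt_four (i := ⟨i.val, by omega⟩) (j := ⟨j.val, by omega⟩) i.2 j.2

/-- The neighbours of a vertex of `parentGraph n par` other than its children. -/
def coreNeighbors (par : ℕ → ℕ) : ℕ → Finset ℕ
  | 0 => {1, 2, 3}
  | 1 => {0, 2, 3}
  | 2 => {0, 1}
  | 3 => {0, 1}
  | j + 4 => {par (j + 4)}

/-- The number of neighbours of a vertex of `parentGraph n par` other than its children. -/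
def coreDegree : ℕ → ℕ
  | 0 => 3
  | 1 => 3
  | 2 => 2
  | 3 => 2
  | _ + 4 => 1

theorem card_coreNeighbors (par : ℕ → ℕ) (j : ℕ) : #(coreNeighbors par j) = coreDegree j := by
  rcases j with _ | _ | _ | _ | j <;> rfl

theorem mem_coreNeighbors_of_lt_four {i j : ℕ} (hi : i < 4) :
    j ∈ coreNeighbors par i ↔ j < 4 ∧ i ≠ j ∧ (i < 2 ∨ j < 2) := by
  interval_cases i <;> simp only [coreNeighbors, mem_insert, mem_singleton] <;> omega

theorem mem_coreNeighbors_of_four_le {i j : ℕ} (hi : 4 ≤ i) :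
    j ∈ coreNeighbors par i ↔ j = par i := by
  obtain ⟨k, rfl⟩ := Nat.exists_eq_add_of_le' hi
  simp [coreNeighbors]

open Classical in
theorem degree_eq_card_nat (G : SimpleGraph (Fin n)) (i : Fin n) (S : Finset ℕ)
    (hS : ∀ k ∈ S, k < n) (h : ∀ j : Fin n, G.Adj i j ↔ j.val ∈ S) : G.degree i = #S := by
  rw [degree_eq_card G i (univ.filter fun j => j.val ∈ S) fun j => by simp [h]]
  refine card_bij (fun j _ => j.val) (fun j hj => (mem_filter.1 hj).2)
    (fun a _ b _ hab => Fin.ext hab) fun k hk => ⟨⟨k, hS k hk⟩, by simpa using hk, rfl⟩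

-- `R i` counts the child slots of the vertices before `i`; since children are numbered
-- consecutively from 4, those of `i` fill the interval from `R i + 4` up to, but excluding, `R (i +
-- 1) + 4`.
open Classical in
theorem IsMonotoneParent.degree_eq (h : IsMonotoneParent n par) (hn : 4 ≤ n) {R : ℕ → ℕ}
    (hRn : R n + 4 = n) (hR : Monotone R)
    (hpar : ∀ i j, 4 ≤ j → j < n → (i = par j ↔ R i + 4 ≤ j ∧ j < R (i + 1) + 4)) (i : Fin n) :
    (parentGraph n par).degree i = coreDegree i + (R (i + 1) - R i) := by
  have hchild : ∀ j, R i + 4 ≤ j → j < R (i + 1) + 4 → i.val < j ∧ j < n := by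
    intro j hj1 hj2
    have h1 := hR (show i.val + 1 ≤ n from i.2)
    have hjn : j < n := by omega
    have := h.lt j (by omega) hjn
    rw [← (hpar i j (by omega) hjn).2 ⟨hj1, hj2⟩] at this
    exact ⟨this, hjn⟩
  have hcore : ∀ k ∈ coreNeighbors par i, k < 4 ∨ k < i.val := by
    intro k hk
    by_cases hi : i.val < 4
    · exact Or.inl ((mem_coreNeighbors_of_lt_four hi).1 hk).1
    · rw [(mem_coreNeighbors_of_four_le (by omega)).1 hk]
      exact Or.inr (h.lt i (by omega) i.2)
  rw [degree_eq_card_nat _ i (coreNeighbors par i ∪ Ico (R i + 4) (R (i + 1) + 4)),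
    card_union_of_disjoint, card_coreNeighbors, Nat.card_Ico]
  · omega
  · rw [Finset.disjoint_left]
    intro k hk hk2
    rw [mem_Ico] at hk2
    have := hchild k hk2.1 hk2.2
    have := hcore k hk
    omega
  · intro k hk
    rcases mem_union.1 hk with hk | hk
    · have := hcore k hk
      have := i.2
      omega
    · rw [mem_Ico] at hk
      exact (hchild k hk.1 hk.2).2
  · intro j
    rw [mem_union, mem_Ico]
    rcases lt_trichotomy i j with hlt | rfl | hlt
    · rw [parentGraph_adj_of_lt hlt]
      rw [Fin.lt_def] at hlt
      by_cases hj : j.val < 4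
      · rw [mem_coreNeighbors_of_lt_four (by omega)]
        omega
      · rw [hpar i j (by omega) j.2]
        have : j.val ∉ coreNeighbors par i := fun e => by
          have := hcore _ e
          omega
        simp only [this, false_or]
        omega
    · simp only [SimpleGraph.irrefl, false_iff, not_or]
      refine ⟨fun e => ?_, fun e => ?_⟩
      · by_cases hi : i.val < 4
        · have := (mem_coreNeighbors_of_lt_four hi).1 e
          omega
        · have := hcore _ e
          omega
      · have := hchild _ e.1 e.2
        omega
    · rw [SimpleGraph.adj_comm, parentGraph_adj_of_lt hlt]
      rw [Fin.lt_def] at hlt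
      have hno : ¬ (R i + 4 ≤ j.val ∧ j.val < R (i.val + 1) + 4) := fun e => by
        have := hchild _ e.1 e.2
        omega
      by_cases hi : i.val < 4
      · rw [mem_coreNeighbors_of_lt_four hi]
        omega
      · rw [mem_coreNeighbors_of_four_le (by omega)]
        omega

end Bicyclic

/-! ### Existence -/

namespace Bicyclic

open Finset

variable {n : ℕ} {π : Fin n → ℕ}

theorem IsBicyclicDegreeSequence.lt_card (h : IsBicyclicDegreeSequence π) (i : Fin n) : π i < n := by
  classical
  obtain ⟨-, G, -, v, hv⟩ := h
  rw [← hv]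
  simpa using G.degree_lt_card_verts (v i)

/-- A balanced partition of `N` into `k` parts. Raising `N` by one shifts the window of summation,
replacing `N / k` by `(N + k) / k = N / k + 1`. -/
theorem sum_range_add_div (N k : ℕ) (hk : 0 < k) : ∑ i ∈ range k, (N + i) / k = N := by
  induction N with
  | zero =>
    refine sum_eq_zero fun i hi => ?_
    rw [zero_add]
    exact Nat.div_eq_of_lt (mem_range.1 hi)
  | succ N ih =>
    have h1 := sum_range_succ (fun i => (N + i) / k) k
    rw [sum_range_succ', ih, Nat.add_div_right _ hk, add_zero] at h1
    have h2 : ∑ i ∈ range k, (N + 1 + i) / k = ∑ i ∈ range k, (N + (i + 1)) / k :=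
      sum_congr rfl fun i _ => by rw [add_assoc, add_comm 1 i]
    omega

theorem exists_isBM₂ {k : ℕ} (hk : 1 ≤ k) (hkn : k + 5 ≤ n) :
    ∃ B : SimpleGraph (Fin n), IsBM₂ n (k + 4) B := by
  let l : Fin k → ℕ := fun i => (n - 5 + i) / k
  have hcard : Fintype.card (Fin 5 ⊕ (i : Fin k) × Fin (l i)) = n := by
    rw [Fintype.card_sum, Fintype.card_sigma]
    simp only [Fintype.card_fin]
    have := sum_range_add_div (n - 5) k hk
    rw [← Fin.sum_univ_eq_sum_range (fun i => (n - 5 + i) / k)] at this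
    rw [this]
    omega
  let e : Fin n ≃ Fin 5 ⊕ (i : Fin k) × Fin (l i) := (Fintype.equivFinOfCardEq hcard).symm
  refine ⟨(attachPaths B₂ 0 l).comap e, Fintype.card_fin n, l, fun i => ?_, fun i j => ?_,
    ⟨SimpleGraph.Iso.comap e _⟩⟩
  · exact (Nat.one_le_div_iff hk).2 (by omega)
  · change (n - 5 + i.val) / k ≤ (n - 5 + j.val) / k + 1
    rw [← Nat.add_div_right _ hk]
    exact Nat.div_le_div_right (by omega)

theorem sum_coreDegree (m : ℕ) : ∑ k ∈ range (m + 4), coreDegree k = m + 10 := by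
  induction m with
  | zero => rfl
  | succ m ih => rw [show m + 1 + 4 = m + 4 + 1 by ring, sum_range_succ, ih]; rfl

theorem coreDegree_of_four_le {k : ℕ} (hk : 4 ≤ k) : coreDegree k = 1 := by
  obtain ⟨m, rfl⟩ := Nat.exists_eq_add_of_le' hk
  rfl

/-- The vertices before `j` must offer more than `j - 4` child slots, so that `j` can be the child
of an earlier vertex. -/
theorem lt_sum_slots_add_four {d : ℕ → ℕ} (hn : 4 ≤ n) (hanti : ∀ i j, i ≤ j → j < n → d j ≤ d i)
    (hd : ∀ k < n, coreDegree k ≤ d k) (hlast : d (n - 1) = 1)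
    (hR : ∑ k ∈ range n, (d k - coreDegree k) + 4 = n) {j : ℕ} (hj : 4 ≤ j) (hjn : j < n) :
    j < ∑ k ∈ range j, (d k - coreDegree k) + 4 := by
  by_contra! hle
  have hd3 : 2 ≤ d 3 := hd 3 (by omega)
  have hsplit : ∀ {a b : ℕ}, a ≤ b → ∑ k ∈ range a, (d k - coreDegree k) +
      ∑ k ∈ Ico a b, (d k - coreDegree k) = ∑ k ∈ range b, (d k - coreDegree k) :=
    fun hab => sum_range_add_sum_Ico _ hab
  -- If the degrees have dropped to 1 before `j`, no slots come later, so all `n - 4` of them are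
  -- already available.
  by_cases h1 : d (j - 1) = 1
  · have hj5 : 5 ≤ j := by
      by_contra! hlt
      obtain rfl : j = 4 := by omega
      simp at h1
      omega
    have h2 : ∑ k ∈ Ico j n, (d k - coreDegree k) = 0 := by
      refine sum_eq_zero fun k hk => ?_
      rw [mem_Ico] at hk
      have := hanti (j - 1) k (by omega) hk.2
      rw [coreDegree_of_four_le (by omega)]
      omega
    have := hsplit hjn.le
    omega
  · have h2 : 2 ≤ d (j - 1) := by
      have := hd (j - 1) (by omega)
      have : 1 ≤ coreDegree (j - 1) := by
        rcases (j - 1) with _ | _ | _ | _ | m <;> simp [coreDegree]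
      omega
    have h3 : #(Ico 4 j) • 1 ≤ ∑ k ∈ Ico 4 j, (d k - coreDegree k) := by
      refine card_nsmul_le_sum _ _ _ fun k hk => ?_
      rw [mem_Ico] at hk
      have := hanti k (j - 1) (by omega) (by omega)
      rw [coreDegree_of_four_le hk.1]
      omega
    rw [Nat.card_Ico, smul_eq_mul, mul_one] at h3
    have h4 := hsplit hj
    -- Each vertex from 4 to `j - 1` offers a slot, so a shortage means that the first four offer
    -- none. Then `d 2 = 2`, later vertices offer at most one slot each and the last none, too few
    -- for a total of `n - 4`.
    have h5 : ∑ k ∈ range 4, (d k - coreDegree k) = 0 := by omega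
    have h6 : d 2 = 2 := by
      have h7 := (sum_eq_zero_iff.1 h5) 2 (by simp)
      have h8 := hd 2 (by omega)
      simp only [coreDegree] at h7 h8
      omega
    have h9 : ∑ k ∈ Ico 4 (n - 1), (d k - coreDegree k) ≤ #(Ico 4 (n - 1)) • 1 := by
      refine sum_le_card_nsmul _ _ _ fun k hk => ?_
      rw [mem_Ico] at hk
      have := hanti 2 k (by omega) (by omega)
      rw [coreDegree_of_four_le hk.1]
      omega
    rw [Nat.card_Ico, smul_eq_mul, mul_one] at h9
    have h10 := hsplit (show 4 ≤ n - 1 by omega)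
    have h11 := sum_range_succ (fun k => d k - coreDegree k) (n - 1)
    rw [show n - 1 + 1 = n by omega, hlast, coreDegree_of_four_le (by omega)] at h11
    omega

/-- The intervals between consecutive values of `R`, shifted by 4, are disjoint and ordered. The
parent of `j` is the index of the interval containing `j`, one less than the first `m` with `j < R m
+ 4`. -/
theorem exists_parent {R : ℕ → ℕ} (hR : Monotone R) (hR0 : R 0 = 0)
    (hlt : ∀ j, 4 ≤ j → j < n → j < R j + 4) :
    ∃ par, IsMonotoneParent n par ∧
      ∀ i j, 4 ≤ j → j < n → (i = par j ↔ R i + 4 ≤ j ∧ j < R (i + 1) + 4) := by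
  have hex : ∀ j, ∃ i, 4 ≤ j → j < n → i < j ∧ R i + 4 ≤ j ∧ j < R (i + 1) + 4 := by
    intro j
    by_cases hj : 4 ≤ j ∧ j < n
    · have he : ∃ m, j < R m + 4 := ⟨j, hlt j hj.1 hj.2⟩
      have h1 := Nat.find_spec he
      have h2 := Nat.find_min' he (hlt j hj.1 hj.2)
      rcases hm : Nat.find he with _ | m
      · rw [hm, hR0] at h1; omega
      · have h3 := Nat.find_min he (show m < Nat.find he by omega)
        rw [hm] at h1 h2
        exact ⟨m, fun _ _ => ⟨by omega, by omega, h1⟩⟩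
    · exact ⟨0, fun h1 h2 => absurd ⟨h1, h2⟩ hj⟩
  choose par hpar using hex
  have key : ∀ i i' j j', R i + 4 ≤ j → j ≤ j' → j' < R (i' + 1) + 4 → i ≤ i' := by
    intro i i' j j' h1 h2 h3
    by_contra! hlt'
    have := hR (show i' + 1 ≤ i from hlt')
    omega
  refine ⟨par, ⟨fun j h1 h2 => (hpar j h1 h2).1, fun i j h1 h2 h3 =>
    key _ _ i j (hpar i h1 (by omega)).2.1 h2 (hpar j (by omega) h3).2.2⟩, fun i j h1 h2 => ?_⟩
  obtain ⟨-, h4, h5⟩ := hpar j h1 h2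
  constructor
  · rintro rfl; exact ⟨h4, h5⟩
  · rintro ⟨h6, h7⟩
    exact le_antisymm (key _ _ j j h6 le_rfl h5) (key _ _ j j h4 le_rfl h7)

theorem exists_isBM₁ [NeZero n] (hπ : IsBicyclicDegreeSequence π) (h1 : 3 ≤ π 1) (ht : π ⊤ = 1) :
    ∃ B : SimpleGraph (Fin n), IsBM₁ π B := by
  classical
  have hn := hπ.four_le
  have hv0 : (0 : Fin n).val = 0 := rfl
  have hv1 : (1 : Fin n).val = 1 := Nat.mod_eq_of_lt (show 1 < n by omega)
  have hv2 : (2 : Fin n).val = 2 := Nat.mod_eq_of_lt (show 2 < n by omega)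
  have hv3 : (3 : Fin n).val = 3 := Nat.mod_eq_of_lt (show 3 < n by omega)
  let d : ℕ → ℕ := fun k => if hk : k < n then π ⟨k, hk⟩ else 0
  have hdπ : ∀ i : Fin n, d i.val = π i := fun i => dif_pos i.2
  have hanti : ∀ i j, i ≤ j → j < n → d j ≤ d i := fun i j hij hj => by
    rw [hdπ ⟨j, hj⟩, hdπ ⟨i, by omega⟩]
    exact hπ.1 hij
  have hd : ∀ k < n, coreDegree k ≤ d k := by
    intro k hk
    have hd1 : 3 ≤ d 1 := by rw [← hv1, hdπ]; exact h1
    have := hdπ ⟨k, hk⟩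
    simp only at this
    rcases k with _ | _ | _ | _ | k
    · exact hd1.trans (hanti 0 1 (by omega) (by omega))
    · exact hd1
    · rw [this]; exact hπ.two_le _ (by simp)
    · rw [this]; exact hπ.two_le _ (by simp)
    · rw [this]; exact hπ.pos _
  have hlast : d (n - 1) = 1 := by
    rw [hdπ ⟨n - 1, by omega⟩]
    refine Eq.trans ?_ ht
    exact congrArg π (top_le_iff.1 (by
      rw [Fin.le_def]; have := (⊤ : Fin n).2; simp only; omega))
  set R : ℕ → ℕ := fun i => ∑ k ∈ range i, (d k - coreDegree k) with hRdef
  -- The degree total 2(n + 1) minus the core total n + 6 leaves n - 4 slots, one for each vertex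
  -- from the fifth on.
  have hRn : R n + 4 = n := by
    have h2 : R n + ∑ k ∈ range n, coreDegree k = ∑ k ∈ range n, d k := by
      rw [hRdef, ← sum_add_distrib]
      exact sum_congr rfl fun k hk => Nat.sub_add_cancel (hd k (mem_range.1 hk))
    rw [← Fin.sum_univ_eq_sum_range d, sum_congr rfl fun i _ => hdπ i, hπ.sum_eq] at h2
    obtain ⟨m, rfl⟩ := Nat.exists_eq_add_of_le' hn
    rw [sum_coreDegree] at h2
    omega
  have hmono : Monotone R := fun a b hab =>
    sum_le_sum_of_subset (range_subset_range.2 hab)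
  obtain ⟨par, hpar, hiff⟩ := exists_parent hmono (sum_range_zero _) fun j h2 h3 =>
    lt_sum_slots_add_four hn hanti hd hlast hRn h2 h3
  have hdeg : ∀ i, (parentGraph n par).degree i = π i := by
    intro i
    rw [hpar.degree_eq hn hRn hmono hiff i, ← hdπ]
    have h2 : R (i.val + 1) = R i + (d i - coreDegree i) := sum_range_succ _ _
    have := hd i i.2
    omega
  refine ⟨parentGraph n par, Equiv.refl _, hdeg, hpar.isBFSOrdering fun i j hij => ?_,
    baseGraphIso hn, Fin.ext hv0.symm, Fin.ext hv1.symm, Fin.ext hv2.symm, Fin.ext hv3.symm⟩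
  rw [hdeg, hdeg]
  exact hπ.1 hij

theorem exists_isBM [NeZero n] (hπ : IsBicyclicDegreeSequence π) :
    ∃ B : SimpleGraph (Fin n), IsBM π B := by
  have hn := hπ.four_le
  rcases hπ.cases with ⟨h1, h2, h3⟩ | ⟨h1, h2, h3⟩ | h | h
  · obtain ⟨B, hB⟩ := exists_isBM₁ hπ h2 h3
    exact ⟨B, Or.inl ⟨h1, h2, h3, hB⟩⟩
  · have := hπ.lt_card 0
    obtain ⟨B, hB⟩ := exists_isBM₂ (n := n) (k := π 0 - 4) (by omega) (by omega)
    rw [Nat.sub_add_cancel (by omega)] at hB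
    exact ⟨B, Or.inr (Or.inl ⟨h1, h2, h3, hB⟩)⟩
  · have h0 := hπ.lt_card 0
    rw [h, if_pos rfl] at h0
    exact ⟨B₃ n 3, Or.inr (Or.inr (Or.inl ⟨h, 3, le_rfl, by omega, ⟨SimpleGraph.Iso.refl⟩⟩))⟩
  · exact ⟨B₅ n 3, Or.inr (Or.inr (Or.inr ⟨h, 3, le_rfl, hn, ⟨SimpleGraph.Iso.refl⟩⟩))⟩

theorem IsBM.attainsBound [NeZero n] (hπ : IsBicyclicDegreeSequence π) {V : Type*} [Fintype V]
    {B : SimpleGraph V} (h : IsBM π B) : InGamma π B ∧ AttainsBound B := by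
  rcases h with ⟨-, -, -, h⟩ | ⟨h0, h1, -, h⟩ | ⟨h, p, hp, hpn, ⟨e⟩⟩ | ⟨h, p, hp, hpn, ⟨e⟩⟩
  · exact h.attainsBound hπ.four_le hπ.sum_eq
  · exact h.attainsBound hπ h0 h1
  · exact ⟨(B₃_inGamma h hp hpn).of_iso e.symm, (B₃_attainsBound hp hpn).of_iso e.symm⟩
  · exact ⟨(B₅_inGamma h hp hpn).of_iso e.symm, (B₅_attainsBound hp hpn).of_iso e.symm⟩

end Bicyclic

theorem mainTheorem2 {n : ℕ} [NeZero n] (π : Fin n → ℕ)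
    (hπ : Bicyclic.IsBicyclicDegreeSequence π) :
    (∃ B : SimpleGraph (Fin n), Bicyclic.IsBM π B) ∧
    ∀ (V : Type u) [Fintype V] (B : SimpleGraph V), Bicyclic.IsBM π B →
      ∀ f : ℝ → ℝ → ℝ, Bicyclic.IsExtremal f π B :=
  ⟨Bicyclic.exists_isBM hπ, fun _ _ _ hB f =>
    have h := hB.attainsBound hπ
    Bicyclic.isExtremal_of_attainsBound hπ.sum_eq h.1 h.2 f⟩
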